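/- Let $K$ be a finite connected simple graph that is a cactus (any two different cycles of $K$ have at most one vertex in common), with $n$ vertices and with positive real vertex weights $w(v)$. Call a vertex a $G$-vertex if it lies on no cycle, and a hinge if it lies on a cycle and has degree at least $3$. A graft is a maximal set of $G$-vertices and hinges that induces a tree none of whose edges lies on a cycle, provided that it has at least two vertices; the blocks of $K$ are its cycles and its grafts, and $b$ denotes their number. Let a depth first search of $K$ be given by its data structure: the vertices in the order of the visit, and for each vertex $v$ its father $\mathrm{FATHER}(v)$ (the starting vertex being its own father), the number $\mathrm{IND}(v)$ of its sons in the DFS tree, the vertex $\mathrm{ROOT}(v)$, which is the first visited vertex of the cycle that contains $v$ and is entered before $v$ (and $\mathrm{ROOT}(v)=v$ if there is no such cycle), and $\mathrm{ORIEN}(v)$, the son of $\mathrm{ROOT}(v)$ on that cycle (and $\mathrm{ORIEN}(v)=v$ if $\mathrm{ROOT}(v)=v$). Then $b<n$. Moreover there is one algorithm, the same for all $K$, $w$ and all depth first searches of $K$, which from the DFS data structure and the weights computes the weighted domination number $\gamma_w(K)=\min\{\sum_{v\in D}w(v) : D \text{ a dominating set of } K\}$, where the weights are processed only by additions and subtractions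 (both counted as additions), $\min$-operations, copying, and the constants $0$ and $\infty$, and which uses fewer than $12n+5b$ additions and fewer than $9n+2b$ $\min$-operations. -/

import Mathlib

namespace Cactus

/-! ### Weighted domination -/

/-- `D` is a dominating set: every vertex belongs to `D` or has a neighbour in `D`. -/
def IsDominating {V : Type*} (G : SimpleGraph V) (D : Finset V) : Prop :=
  ∀ v, v ∈ D ∨ ∃ u ∈ D, G.Adj u v

theorem isDominating_univ {V : Type*} [Fintype V] (G : SimpleGraph V) :
    IsDominating G Finset.univ :=
  fun v => Or.inl (Finset.mem_univ v)

open Classical in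
/-- The weighted domination number: the minimum, over all dominating sets `D`, of the weight
`∑ v ∈ D, w v`. -/
noncomputable def weightedDominationNumber {V : Type*} [Fintype V] (G : SimpleGraph V)
    (w : V → ℝ) : ℝ :=
  (Finset.univ.filter fun D : Finset V => IsDominating G D).inf'
    ⟨Finset.univ, Finset.mem_filter.2 ⟨Finset.mem_univ _, isDominating_univ G⟩⟩
    (fun D => ∑ v ∈ D, w v)

/-! ### Cactus graphs and their blocks -/

/-- The subgraph `C` of `G` is a cycle of `G`. -/
def IsCycleOf {V : Type*} (G : SimpleGraph V) (C : G.Subgraph) : Prop :=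
  ∃ (v : V) (p : G.Walk v v), p.IsCycle ∧ C = p.toSubgraph

/-- A cactus: a connected graph in which two different cycles share at most one vertex. -/
structure IsCactus {V : Type*} (G : SimpleGraph V) : Prop where
  connected : G.Connected
  cycles : ∀ C₁ C₂ : G.Subgraph, IsCycleOf G C₁ → IsCycleOf G C₂ → C₁ ≠ C₂ →
    (C₁.verts ∩ C₂.verts).Subsingleton

/-- `v` lies on some cycle of `G`. -/
def OnCycle {V : Type*} (G : SimpleGraph V) (v : V) : Prop :=
  ∃ C : G.Subgraph, IsCycleOf G C ∧ v ∈ C.verts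

/-- A `G`-vertex: a vertex that lies on no cycle. -/
def IsGVertex {V : Type*} (G : SimpleGraph V) (v : V) : Prop := ¬ OnCycle G v

/-- An `H`-vertex (hinge): a vertex of degree at least 3 that lies on a cycle. -/
def IsHVertex {V : Type*} (G : SimpleGraph V) (v : V) : Prop :=
  OnCycle G v ∧ 3 ≤ (G.neighborSet v).encard

/-- A subtree of a cactus: a set of `G`-vertices and `H`-vertices that induces a tree, none of
whose edges is an edge of a cycle. -/
structure IsSubtree {V : Type*} (G : SimpleGraph V) (S : Set V) : Prop where
  vertices : ∀ v ∈ S, IsGVertex G v ∨ IsHVertex G v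
  tree : (G.induce S).IsTree
  edges : ∀ u ∈ S, ∀ v ∈ S, ∀ C : G.Subgraph, IsCycleOf G C → ¬ C.Adj u v

/-- A graft: a maximal subtree, with at least two vertices (equivalently, with an edge). -/
def IsGraft {V : Type*} (G : SimpleGraph V) (S : Set V) : Prop :=
  Maximal (IsSubtree G) S ∧ S.Nontrivial

/-- The number of blocks: the number of cycles plus the number of grafts. -/
noncomputable def numBlocks {V : Type*} (G : SimpleGraph V) : ℕ :=
  {C : G.Subgraph | IsCycleOf G C}.ncard + {S : Set V | IsGraft G S}.ncard

/-! ### The DFS data structure -/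

/-- The data recorded by a run of depth first search on `G`: the order `dfn` in which the vertices
are visited, and the arrays FATHER, ROOT, ORIEN and IND. -/
structure DFSData {V : Type*} [Fintype V] (G : SimpleGraph V) where
  dfn : V ≃ Fin (Fintype.card V)
  father : V → V
  root : V → V
  orien : V → V
  ind : V → ℕ
  /-- The starting vertex is its own father. -/
  father_start : ∀ v, (dfn v : ℕ) = 0 → father v = v
  /-- Any other vertex `v` is visited from its father, an adjacent vertex visited earlier. -/
  father_adj : ∀ v, (dfn v : ℕ) ≠ 0 → G.Adj (father v) v
  father_lt : ∀ v, (dfn v : ℕ) ≠ 0 → dfn (father v) < dfn v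
  /-- The search is depth first: `father v` is the most recently visited vertex that still has
  unvisited neighbours when `v` is visited. -/
  depth_first : ∀ v, (dfn v : ℕ) ≠ 0 → ∀ u x, dfn (father v) < dfn u → dfn u < dfn v →
    G.Adj u x → dfn x < dfn v
  /-- If `v` lies on a cycle whose first visited vertex is `x ≠ v`, then `root v = x`. -/
  root_of_cycle : ∀ v x, ∀ C : G.Subgraph, IsCycleOf G C → v ∈ C.verts → x ∈ C.verts →
    (∀ y ∈ C.verts, dfn x ≤ dfn y) → x ≠ v → root v = x
  /-- If there is no such cycle, then `root v = v`. -/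
  root_self : ∀ v, (∀ C : G.Subgraph, IsCycleOf G C → v ∈ C.verts →
    ∀ y ∈ C.verts, dfn v ≤ dfn y) → root v = v
  /-- If `root v ≠ v`, then `orien v` is the son of `root v` on the cycle that contains `v` and
  has the first visited vertex `root v`. -/
  orien_of_cycle : ∀ v z, ∀ C : G.Subgraph, IsCycleOf G C → v ∈ C.verts → z ∈ C.verts →
    root v ∈ C.verts → (∀ y ∈ C.verts, dfn (root v) ≤ dfn y) → root v ≠ v →
    z ≠ root v → father z = root v → orien v = z
  orien_self : ∀ v, root v = v → orien v = v
  /-- `ind v` is the number of sons of `v`. -/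
  ind_eq : ∀ v, ind v = {u | u ≠ v ∧ father u = v}.ncard

/-! ### The machine model

Programs compute on two separate kinds of data: natural numbers (indices), kept in registers and
arrays, and values in `EReal`, kept in arrays. The only operations on values are the assignment of
`0` and `∞`, copying, addition, subtraction and `min`; values never influence the flow of control
or an index. Subtractions are counted as additions. All loops are bounded, so every program
terminates on every input. -/

/-- Index expressions. -/
inductive IExp where
  | const (k : ℕ)
  | reg (x : ℕ)
  | get (a : ℕ) (e : IExp)
  | add (e₁ e₂ : IExp)
  | sub (e₁ e₂ : IExp)

/-- A reference to the cell at position `pos` of the value array with number `arr`. -/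
structure VRef where
  arr : ℕ
  pos : IExp

/-- Programs. -/
inductive Prog where
  /-- do nothing -/
  | skip
  /-- index register `x` := `e` -/
  | setReg (x : ℕ) (e : IExp)
  /-- index array `a` at position `i` := `e` -/
  | setIdx (a : ℕ) (i e : IExp)
  /-- value `d` := 0 -/
  | zero (d : VRef)
  /-- value `d` := ∞ -/
  | infty (d : VRef)
  /-- value `d` := `p` -/
  | copy (d p : VRef)
  /-- value `d` := `p + q` -/
  | add (d p q : VRef)
  /-- value `d` := `p - q` -/
  | sub (d p q : VRef)
  /-- value `d` := `min p q` -/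
  | min (d p q : VRef)
  /-- sequential composition -/
  | seq (P Q : Prog)
  /-- if `e₁ = e₂` then `P` else `Q` -/
  | ifEq (e₁ e₂ : IExp) (P Q : Prog)
  /-- if `e₁ < e₂` then `P` else `Q` -/
  | ifLt (e₁ e₂ : IExp) (P Q : Prog)
  /-- for register `x` = 0, …, `e - 1` do `P`, where `e` is evaluated once, before the loop -/
  | loop (x : ℕ) (e : IExp) (P : Prog)

/-- The state of the machine: the index registers, the index arrays, the value arrays, and the
numbers of additions and of min-operations carried out so far. -/
@[ext] structure State where
  reg : ℕ → ℕ
  idx : ℕ → ℕ → ℕ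
  val : ℕ → ℕ → EReal
  adds : ℕ
  mins : ℕ

/-- The value of an index expression. -/
def IExp.eval (s : State) : IExp → ℕ
  | const k => k
  | reg x => s.reg x
  | get a e => s.idx a (e.eval s)
  | add e₁ e₂ => e₁.eval s + e₂.eval s
  | sub e₁ e₂ => e₁.eval s - e₂.eval s

/-- The value stored in a cell. -/
def VRef.eval (s : State) (p : VRef) : EReal := s.val p.arr (p.pos.eval s)

/-- Assignment to an index register. -/
def State.setReg (s : State) (x k : ℕ) : State :=
  { s with reg := Function.update s.reg x k }

/-- Assignment to a cell of an index array. -/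
def State.setIdx (s : State) (a i k : ℕ) : State :=
  { s with idx := Function.update s.idx a (Function.update (s.idx a) i k) }

/-- Assignment to a value cell. -/
noncomputable def State.setVal (s : State) (d : VRef) (y : EReal) : State :=
  { s with
    val := Function.update s.val d.arr (Function.update (s.val d.arr) (d.pos.eval s) y) }

/-- The result of running a program. -/
noncomputable def Prog.run : Prog → State → State
  | skip, s => s
  | setReg x e, s => s.setReg x (e.eval s)
  | setIdx a i e, s => s.setIdx a (i.eval s) (e.eval s)
  | zero d, s => s.setVal d 0
  | infty d, s => s.setVal d ⊤
  | copy d p, s => s.setVal d (p.eval s)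
  | add d p q, s => { s.setVal d (p.eval s + q.eval s) with adds := s.adds + 1 }
  | sub d p q, s => { s.setVal d (p.eval s - q.eval s) with adds := s.adds + 1 }
  | min d p q, s => { s.setVal d (p.eval s ⊓ q.eval s) with mins := s.mins + 1 }
  | seq P Q, s => Q.run (P.run s)
  | ifEq e₁ e₂ P Q, s => if e₁.eval s = e₂.eval s then P.run s else Q.run s
  | ifLt e₁ e₂ P Q, s => if e₁.eval s < e₂.eval s then P.run s else Q.run s
  | loop x e P, s => (List.range (e.eval s)).foldl (fun t i => P.run (t.setReg x i)) s

/-- The array that holds `f v` at position `dfn v`, and `0` beyond the last vertex. -/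
def table {V : Type*} [Fintype V] {G : SimpleGraph V} (D : DFSData G) {α : Type*} [Zero α]
    (f : V → α) (i : ℕ) : α :=
  if h : i < Fintype.card V then f (D.dfn.symm ⟨i, h⟩) else 0

/-- The initial state. Every vertex is represented by its depth first number. Register 0 holds the
number of vertices, the index arrays 0, 1, 2, 3 hold FATHER, ROOT, ORIEN, IND, and the value
array 0 holds the weights; everything else is 0. -/
noncomputable def inputState {V : Type*} [Fintype V] {G : SimpleGraph V} (D : DFSData G)
    (w : V → ℝ) : State where
  reg := fun x => if x = 0 then Fintype.card V else 0
  idx := fun a => match a with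
    | 0 => table D fun v => (D.dfn (D.father v) : ℕ)
    | 1 => table D fun v => (D.dfn (D.root v) : ℕ)
    | 2 => table D fun v => (D.dfn (D.orien v) : ℕ)
    | 3 => table D D.ind
    | _ => fun _ => 0
  val := fun a => match a with
    | 0 => table D fun v => (w v : EReal)
    | _ => fun _ => 0
  adds := 0
  mins := 0

/-- The output of a computation: the cell at position 0 of the value array 1. -/
def State.output (s : State) : EReal := s.val 1 0

end Cactus

/-!
A depth first search of a cactus yields a spanning tree in which every other edge, a back edge,
joins a vertex to an ancestor. The fundamental cycles of two back edges that cover the same tree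
edge share both of its ends, so in a cactus they coincide: every tree edge is covered by at most one
back edge (`DFSData.Covers.unique`). It follows that `ROOT u` is the upper end of the back edge that
covers the tree edge above `u`, if there is one, and that the lower ends of the back edges can be
read off the arrays `ROOT` and `FATHER` (`DFSData.exists_back_iff`).

The program is a dynamic programming over this tree. The vertices are joined to their fathers in the
reverse of the order of the visit; at any time the vertices are thus partitioned into subtrees, the
parts `DFSData.Part`. For each part there are three values: the minimum weight of a subset that
dominates the part, where the top of the part is in the subset, is not in the subset but dominated
by it, or is neither required to be dominated nor in the subset. The lower end `y` of a back edge
that leaves the part towards a proper ancestor `z` of its top calls for three modes: `y` is dominated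
by `z`, or `y` gets no help from `z`, or `y` has to be in the subset since it is to dominate `z`.

When `u` is joined to its father `v`, the new values in each mode are obtained from those of `v` and
from three contributions of `u` by 4 additions and one `min`-operation (`IsTable.join`). If `v` is
not `ROOT u`, the contributions in each mode come from the values of `u` in the same mode
(`IsTable.join_of_root_ne`). If `v` is `ROOT u`, the cycle closes at `v`, and the contributions come
from the mode that fits the state of `v` (`IsTable.join_of_root_eq`). This makes 12 additions and at
most `3 + 6` `min`-operations for each vertex except the starting vertex, which needs a single final
`min`-operation.

For the number of blocks, every cycle and every graft contains a tree edge, and different blocks have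
no edge in common (`numBlocks_lt`); there is one tree edge for each vertex except the starting vertex.
-/

namespace Cactus

namespace DFSData

variable {V : Type*} [Fintype V] {G : SimpleGraph V}

/-! ### The depth first search tree -/

/-- `D.Part k v x`: following fathers leads from `x` to `v`, and all vertices met before `v` have
depth first number at least `k`. For fixed `k`, the sets `D.Part k v` with `dfn v < k` are the
trees of the forest formed by the edges from the vertices numbered `k` or more to their fathers. -/
inductive Part (D : DFSData G) (k : ℕ) (v : V) : V → Prop
  | refl : Part D k v v
  | step {x : V} : k ≤ (D.dfn x : ℕ) → Part D k v (D.father x) → Part D k v x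

/-- `v` is an ancestor of `x` in the search tree, or `v = x`. -/
abbrev Anc (D : DFSData G) (v x : V) : Prop := D.Part 0 v x

variable {D : DFSData G} {k : ℕ} {u v x y z : V}

theorem eq_of_dfn (h : (D.dfn x : ℕ) = D.dfn y) : x = y :=
  D.dfn.injective (Fin.ext h)

theorem father_dfn_lt (h : (D.dfn v : ℕ) ≠ 0) : (D.dfn (D.father v) : ℕ) < D.dfn v :=
  D.father_lt v h

theorem father_dfn_le (D : DFSData G) (v : V) : (D.dfn (D.father v) : ℕ) ≤ D.dfn v := by
  by_cases h : (D.dfn v : ℕ) = 0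
  · rw [D.father_start v h]
  · exact (father_dfn_lt h).le

namespace Part

theorem mono {l : ℕ} (hkl : l ≤ k) (h : D.Part k v x) : D.Part l v x := by
  induction h with
  | refl => exact .refl
  | step hx _ ih => exact .step (hkl.trans hx) ih

theorem dfn_le (h : D.Part k v x) : (D.dfn v : ℕ) ≤ D.dfn x := by
  induction h with
  | refl => exact le_rfl
  | step _ _ ih => exact ih.trans (D.father_dfn_le _)

theorem eq_of_lt (h : D.Part k v x) (hx : (D.dfn x : ℕ) < k) : x = v := by
  cases h with
  | refl => rfl
  | step h _ => omega

theorem unique (hu : (D.dfn u : ℕ) < k) (hv : (D.dfn v : ℕ) < k) (h : D.Part k u x)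
    (h' : D.Part k v x) : u = v := by
  induction h with
  | refl => exact h'.eq_of_lt hu
  | step hx _ ih =>
    cases h' with
    | refl => omega
    | step _ h' => exact ih h'

/-- Joining the tree of `u`, which has the number `k`, to the tree of its father. -/
theorem iff_succ (hk : (D.dfn u : ℕ) = k) (hu : k ≠ 0) :
    D.Part k v x ↔ D.Part (k + 1) v x ∨ (v = D.father u ∧ D.Part (k + 1) u x) := by
  have hlt : (D.dfn (D.father u) : ℕ) < D.dfn u := father_dfn_lt (by omega)
  constructor
  · intro h
    induction h with
    | refl => exact .inl .refl
    | @step x hx _ ih =>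
      rcases hx.eq_or_lt with h | h
      · obtain rfl : u = x := eq_of_dfn (D := D) (by omega)
        rcases ih with ih | ⟨-, ih⟩
        · exact .inr ⟨(ih.eq_of_lt (by omega)).symm, .refl⟩
        · have := ih.dfn_le
          omega
      · exact ih.imp (.step h) fun ih => ⟨ih.1, .step h ih.2⟩
  · rintro (h | ⟨rfl, h⟩)
    · exact h.mono k.le_succ
    · induction h with
      | refl => exact .step hk.ge .refl
      | step hx _ ih => exact .step (by omega) ih

theorem iff_anc : D.Part (D.dfn u + 1) u x ↔ D.Anc u x := by
  refine ⟨fun h => h.mono (Nat.zero_le _), fun h => ?_⟩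
  induction h with
  | refl => exact .refl
  | @step x _ h ih =>
    by_cases hx : (D.dfn u : ℕ) + 1 ≤ D.dfn x
    · exact .step hx ih
    · have := h.dfn_le
      have := D.father_dfn_le x
      obtain rfl : u = x := eq_of_dfn (D := D) (by omega)
      exact .refl

end Part

namespace Anc

theorem trans (h : D.Anc u v) (h' : D.Anc v x) : D.Anc u x := by
  induction h' with
  | refl => exact h
  | step hx _ ih => exact .step hx ih

theorem total (h : D.Anc u x) (h' : D.Anc v x) (huv : (D.dfn u : ℕ) ≤ D.dfn v) :
    D.Anc u v := by
  induction h' with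
  | refl => exact h
  | @step x _ h' ih =>
    cases h with
    | refl =>
      have := h'.dfn_le
      have := D.father_dfn_le u
      obtain rfl : u = v := eq_of_dfn (D := D) (by omega)
      exact .refl
    | step _ h => exact ih h

theorem father (h : D.Anc u v) (hne : u ≠ v) : D.Anc u (D.father v) := by
  cases h with
  | refl => exact absurd rfl hne
  | step _ h => exact h

/-- In a depth first search every edge joins a vertex to one of its ancestors. -/
theorem of_adj (h : G.Adj x z) (hzx : (D.dfn z : ℕ) < D.dfn x) : D.Anc z x := by
  suffices H : ∀ m, ∀ t, (D.dfn t : ℕ) = m → D.Anc t x → (D.dfn z : ℕ) ≤ D.dfn t → D.Anc z t from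
    H _ x rfl .refl hzx.le
  intro m
  induction m using Nat.strong_induction_on with
  | _ m ih =>
    rintro t rfl htx hzt
    by_cases hz : (D.dfn z : ℕ) = D.dfn t
    · obtain rfl : z = t := eq_of_dfn (D := D) hz
      exact .refl
    · have h0 : (D.dfn t : ℕ) ≠ 0 := by omega
      by_cases hf : (D.dfn z : ℕ) ≤ D.dfn (D.father t)
      · exact .step (Nat.zero_le _)
          (ih _ (father_dfn_lt h0) _ rfl (trans (.step (Nat.zero_le _) .refl) htx) hf)
      · have h1 : (D.dfn x : ℕ) < D.dfn t :=
          D.depth_first t h0 z x (Fin.lt_def.2 (by omega)) (Fin.lt_def.2 (by omega)) h.symm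
        have := htx.dfn_le
        omega

theorem exists_path (h : D.Anc z x) : ∃ p : G.Walk x z, p.IsPath ∧
    (∀ y, y ∈ p.support ↔ D.Anc z y ∧ D.Anc y x) ∧ ∀ e ∈ p.edges, ∃ t, e = s(t, D.father t) := by
  induction h with
  | refl =>
    refine ⟨.nil, .nil, fun y => ?_, by simp⟩
    rw [SimpleGraph.Walk.support_nil, List.mem_singleton]
    refine ⟨by rintro rfl; exact ⟨.refl, .refl⟩, fun h => ?_⟩
    exact eq_of_dfn (D := D) (le_antisymm h.2.dfn_le h.1.dfn_le)
  | @step x _ h ih =>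
    by_cases h0 : (D.dfn x : ℕ) = 0
    · rwa [D.father_start x h0] at ih
    · obtain ⟨p, hp, hs, he⟩ := ih
      have hlt := father_dfn_lt h0
      refine ⟨.cons (D.father_adj x h0).symm p, ?_, fun y => ?_, ?_⟩
      · rw [SimpleGraph.Walk.cons_isPath_iff]
        refine ⟨hp, fun hx => ?_⟩
        have := ((hs x).1 hx).2.dfn_le
        omega
      · rw [SimpleGraph.Walk.support_cons, List.mem_cons, hs]
        constructor
        · rintro (rfl | ⟨h1, h2⟩)
          · exact ⟨.step (Nat.zero_le _) h, .refl⟩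
          · exact ⟨h1, .step (Nat.zero_le _) h2⟩
        · rintro ⟨h1, h2⟩
          by_cases hy : y = x
          · exact .inl hy
          · exact .inr ⟨h1, h2.father hy⟩
      · intro e he'
        rw [SimpleGraph.Walk.edges_cons, List.mem_cons] at he'
        rcases he' with rfl | he'
        · exact ⟨x, rfl⟩
        · exact he e he'

end Anc

/-! ### Back edges and the cycles of a cactus -/

/-- The edge from `x` to the earlier vertex `z` is a back edge, that is, not a tree edge. -/
structure Back (D : DFSData G) (x z : V) : Prop where
  adj : G.Adj x z
  lt : (D.dfn z : ℕ) < D.dfn x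
  ne : D.father x ≠ z

/-- The back edge from `x` to `z` leads from a descendant of `u` to a proper ancestor of `u`; its
fundamental cycle then passes through the tree edge from `u` to its father. -/
structure Covers (D : DFSData G) (x z u : V) : Prop where
  back : D.Back x z
  anc : D.Anc u x
  lt : (D.dfn z : ℕ) < D.dfn u

theorem Back.anc (h : D.Back x z) : D.Anc z x := .of_adj h.adj h.lt

theorem Back.covers (h : D.Back x z) : D.Covers x z x := ⟨h, .refl, h.lt⟩

theorem Covers.anc_father (h : D.Covers x z u) : D.Anc z (D.father u) :=
  Anc.father (h.back.anc.total h.anc h.lt.le) (by rintro rfl; exact h.lt.false)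

/-- The fundamental cycle of a back edge. -/
theorem Back.exists_cycle (h : D.Back x z) : ∃ C : G.Subgraph, IsCycleOf G C ∧
    (∀ y, y ∈ C.verts ↔ D.Anc z y ∧ D.Anc y x) ∧ C.Adj x z ∧
    ∀ a b, C.Adj a b → s(a, b) = s(x, z) ∨ ∃ t, s(a, b) = s(t, D.father t) := by
  obtain ⟨p, hp, hs, he⟩ := h.anc.exists_path
  have hc : (SimpleGraph.Walk.cons h.adj.symm p).IsCycle := by
    rw [SimpleGraph.Walk.cons_isCycle_iff]
    refine ⟨hp, fun hm => ?_⟩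
    obtain ⟨t, ht⟩ := he _ hm
    rcases Sym2.eq_iff.1 ht with ⟨rfl, h1⟩ | ⟨h1, rfl⟩
    · have := D.father_dfn_le z
      have := h.lt
      rw [← h1] at *
      omega
    · exact h.ne h1.symm
  refine ⟨_, ⟨z, _, hc, rfl⟩, fun y => ?_, ?_, fun a b hab => ?_⟩
  · rw [SimpleGraph.Walk.mem_verts_toSubgraph, SimpleGraph.Walk.support_cons, List.mem_cons, hs]
    refine ⟨?_, .inr⟩
    rintro (rfl | h')
    · exact ⟨.refl, h.anc⟩
    · exact h'
  · rw [SimpleGraph.Walk.adj_toSubgraph_iff_mem_edges, SimpleGraph.Walk.edges_cons, List.mem_cons]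
    exact .inl Sym2.eq_swap
  · rw [SimpleGraph.Walk.adj_toSubgraph_iff_mem_edges, SimpleGraph.Walk.edges_cons,
      List.mem_cons] at hab
    exact hab.imp (fun h => h.trans Sym2.eq_swap) (he _)

/-- In a cactus every tree edge is covered by at most one back edge, since the fundamental cycles
of two such back edges share the tree edge. -/
theorem Covers.unique (hG : IsCactus G) {x' z' : V} (h : D.Covers x z u)
    (h' : D.Covers x' z' u) : x' = x ∧ z' = z := by
  obtain ⟨C, hC, hv, -, hedge⟩ := h.back.exists_cycle
  obtain ⟨C', hC', hv', hadj, -⟩ := h'.back.exists_cycle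
  have hfu : D.Anc (D.father u) u := .step (Nat.zero_le _) .refl
  have hlt : (D.dfn (D.father u) : ℕ) < D.dfn u := father_dfn_lt (by have := h.lt; omega)
  have hCC : C = C' := by
    by_contra hne
    have := hG.cycles C C' hC hC' hne
      ⟨(hv u).2 ⟨h.anc_father.trans hfu, h.anc⟩, (hv' u).2 ⟨h'.anc_father.trans hfu, h'.anc⟩⟩
      ⟨(hv _).2 ⟨h.anc_father, hfu.trans h.anc⟩, (hv' _).2 ⟨h'.anc_father, hfu.trans h'.anc⟩⟩
    rw [← this] at hlt
    exact hlt.false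
  subst hCC
  have hl := h.back.lt
  have hl' := h'.back.lt
  rcases hedge _ _ hadj with h1 | ⟨t, ht⟩
  · rcases Sym2.eq_iff.1 h1 with h2 | ⟨rfl, rfl⟩
    · exact h2
    · omega
  · rcases Sym2.eq_iff.1 ht with ⟨rfl, h2⟩ | ⟨rfl, rfl⟩
    · exact absurd h2.symm h'.back.ne
    · have := D.father_dfn_le z'
      omega

theorem Covers.root_eq (h : D.Covers x z u) : D.root u = z := by
  obtain ⟨C, hC, hv, -⟩ := h.back.exists_cycle
  have hfu : D.Anc (D.father u) u := .step (Nat.zero_le _) .refl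
  exact D.root_of_cycle u z C hC ((hv u).2 ⟨h.anc_father.trans hfu, h.anc⟩)
    ((hv z).2 ⟨.refl, h.back.anc⟩) (fun y hy => Fin.le_def.2 ((hv y).1 hy).1.dfn_le)
    (by rintro rfl; exact h.lt.false)

/-- An edge that leaves the set of descendants of `u` is the tree edge above `u`, or a back edge
that covers it. -/
theorem eq_or_covers_of_adj (h : G.Adj x z) (hx : D.Anc u x) (hz : ¬ D.Anc u z) :
    (x = u ∧ z = D.father u) ∨ D.Covers x z u := by
  have hzx : (D.dfn z : ℕ) < D.dfn x := by
    by_contra hcon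
    rcases (not_lt.1 hcon).eq_or_lt with h1 | h1
    · exact h.ne (eq_of_dfn (D := D) h1)
    · exact hz (hx.trans (.of_adj h.symm h1))
  have hanc : D.Anc z x := .of_adj h hzx
  have hzu : (D.dfn z : ℕ) < D.dfn u := by
    by_contra hcon
    exact hz (hx.total hanc (not_lt.1 hcon))
  by_cases hf : D.father x = z
  · left
    by_cases hux : u = x
    · subst hux
      exact ⟨rfl, hf.symm⟩
    · exact absurd (hf ▸ hx.father hux) hz
  · exact .inr ⟨⟨h, hzx, hf⟩, hx, hzu⟩

/-- A cycle that meets both the descendants of `u` and their complement passes twice between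
them, so it uses an edge other than the tree edge above `u`. -/
theorem exists_covers_of_cycle {C : G.Subgraph} (hC : IsCycleOf G C) (hu : u ∈ C.verts)
    (hy : y ∈ C.verts) (hyu : (D.dfn y : ℕ) < D.dfn u) : ∃ x z, D.Covers x z u := by
  classical
  obtain ⟨v, p, hp, rfl⟩ := hC
  rw [SimpleGraph.Walk.mem_verts_toSubgraph] at hu hy
  have hy' : y ∈ (p.rotate u hu).support := by
    rwa [SimpleGraph.Walk.mem_support_rotate_iff]
  have hq := hp.rotate hu
  set q := p.rotate u hu with hqdef
  by_contra! hno
  have hyanc : ¬ D.Anc u y := fun h => by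
    have := h.dfn_le
    omega
  have key : ∀ d : G.Dart, D.Anc u d.fst → ¬ D.Anc u d.snd → d.edge = s(u, D.father u) := by
    intro d h1 h2
    rcases eq_or_covers_of_adj d.adj h1 h2 with ⟨h3, h4⟩ | h3
    · exact congrArg₂ (fun a b => s(a, b)) h3 h4
    · exact absurd h3 (hno _ _)
  obtain ⟨d, hd, hd1, hd2⟩ := (q.takeUntil y hy').exists_boundary_dart {x | D.Anc u x} .refl hyanc
  obtain ⟨d', hd', hd1', hd2'⟩ :=
    (q.dropUntil y hy').reverse.exists_boundary_dart {x | D.Anc u x} .refl hyanc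
  have e1 : s(u, D.father u) ∈ (q.takeUntil y hy').edges := by
    rw [← key d hd1 hd2]
    exact List.mem_map_of_mem hd
  have e2 : s(u, D.father u) ∈ (q.dropUntil y hy').edges := by
    rw [← key d' hd1' hd2', ← List.mem_reverse, ← SimpleGraph.Walk.edges_reverse]
    exact List.mem_map_of_mem hd'
  have hn := hq.isTrail.edges_nodup
  rw [← q.take_spec hy', SimpleGraph.Walk.edges_append] at hn
  exact (List.disjoint_of_nodup_append hn) e1 e2

theorem exists_covers_of_root_ne (h : D.root u ≠ u) : ∃ x, D.Covers x (D.root u) u := by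
  have : ∃ C : G.Subgraph, IsCycleOf G C ∧ u ∈ C.verts ∧ ∃ y ∈ C.verts, D.dfn y < D.dfn u := by
    by_contra! hcon
    exact h (D.root_self u hcon)
  obtain ⟨C, hC, hu, y, hy, hlt⟩ := this
  obtain ⟨x, z, hxz⟩ := exists_covers_of_cycle hC hu hy hlt
  exact ⟨x, hxz.root_eq ▸ hxz⟩

/-- How the lower end of a back edge is recognized from the arrays `ROOT` and `FATHER`: the tree
edge above `x` is on a cycle, and that cycle does not continue to a son of `x`. -/
theorem exists_back_iff (hG : IsCactus G) :
    (∃ z, D.Back x z) ↔ D.root x ≠ x ∧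
      ∀ c, (D.dfn c : ℕ) ≠ 0 → D.father c = x → D.root c ≠ c → D.root c = x := by
  constructor
  · rintro ⟨z, hz⟩
    have hr := hz.covers.root_eq
    refine ⟨fun h => ?_, fun c hc0 hc hrc => ?_⟩
    · have := hz.lt
      rw [← hr, h] at this
      exact this.false
    · by_contra hcx
      obtain ⟨y, hy⟩ := exists_covers_of_root_ne hrc
      have hanc := hy.anc_father
      rw [hc] at hanc
      have hlt : (D.dfn (D.root c) : ℕ) < D.dfn x :=
        hanc.dfn_le.lt_of_ne fun h => hcx (eq_of_dfn (D := D) h)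
      have hxc : D.Anc x c := .step (Nat.zero_le _) (hc ▸ .refl)
      obtain ⟨rfl, -⟩ := Covers.unique hG hz.covers ⟨hy.back, hxc.trans hy.anc, hlt⟩
      have h1 := hy.anc.dfn_le
      have h2 := father_dfn_lt hc0
      rw [hc] at h2
      omega
  · rintro ⟨hr, hc⟩
    obtain ⟨y, hy⟩ := exists_covers_of_root_ne hr
    suffices y = x from ⟨_, this ▸ hy.back⟩
    by_contra hyx
    -- The son `c` of `x` above `y` is covered by the same back edge.
    obtain ⟨c, hc0, hcx, hcy⟩ : ∃ c, (D.dfn c : ℕ) ≠ 0 ∧ D.father c = x ∧ D.Anc c y := by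
      have h : D.Part (D.dfn x + 1) x y := Part.iff_anc.2 hy.anc
      clear hy
      induction h with
      | refl => exact absurd rfl hyx
      | @step y hy h ih =>
        by_cases hfy : D.father y = x
        · exact ⟨y, by omega, hfy, .refl⟩
        · obtain ⟨c, h1, h2, h3⟩ := ih hfy
          exact ⟨c, h1, h2, .step (Nat.zero_le _) h3⟩
    have h2 := father_dfn_lt hc0
    rw [hcx] at h2
    have hcov : D.Covers y (D.root x) c := ⟨hy.back, hcy, hy.lt.trans h2⟩
    have hrc := hcov.root_eq
    have hne : D.root c ≠ c := by
      intro h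
      have := hcov.lt
      rw [← hrc, h] at this
      exact this.false
    exact hr (hrc ▸ hc c hc0 hcx hne)

end DFSData

end Cactus

namespace Cactus

open DFSData

/-! ### The number of blocks -/

section

variable {V : Type*} {G : SimpleGraph V}

theorem IsCycleOf.eq_of_adj (hG : IsCactus G) {C C' : G.Subgraph} (hC : IsCycleOf G C)
    (hC' : IsCycleOf G C') {a b : V} (h : C.Adj a b) (h' : C'.Adj a b) : C = C' := by
  by_contra hne
  exact h.ne (hG.cycles C C' hC hC' hne ⟨h.fst_mem, h'.fst_mem⟩ ⟨h.snd_mem, h'.snd_mem⟩)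

/-- The ends of an edge of a cycle are not connected by a walk that avoids the edges of cycles. -/
theorem not_adj_of_walk {a b : V} (p : G.Walk a b)
    (hp : ∀ x y, s(x, y) ∈ p.edges → ∀ C : G.Subgraph, IsCycleOf G C → ¬ C.Adj x y)
    {C : G.Subgraph} (hC : IsCycleOf G C) : ¬ C.Adj a b := by
  classical
  intro hab
  have hab' : G.Adj a b := hab.adj_sub
  have hnot : s(b, a) ∉ p.bypass.edges := fun h =>
    hp b a (p.edges_bypass_subset_edges h) C hC hab.symm
  have hcyc : (SimpleGraph.Walk.cons hab'.symm p.bypass).IsCycle := by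
    rw [SimpleGraph.Walk.cons_isCycle_iff]
    exact ⟨p.bypass_isPath, hnot⟩
  have hsub := p.edges_bypass_subset_edges
  generalize p.bypass = q at *
  cases q with
  | nil => exact hab'.ne rfl
  | @cons _ c _ h q =>
    refine hp a c (hsub (by simp)) _ ⟨_, _, hcyc, rfl⟩ ?_
    rw [SimpleGraph.Walk.adj_toSubgraph_iff_mem_edges]
    simp

theorem IsSubtree.exists_walk {S : Set V} (hS : IsSubtree G S) {a b : V} (ha : a ∈ S)
    (hb : b ∈ S) : ∃ p : G.Walk a b, ∀ x y, s(x, y) ∈ p.edges → x ∈ S ∧ y ∈ S := by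
  obtain ⟨p⟩ := hS.tree.connected.preconnected ⟨a, ha⟩ ⟨b, hb⟩
  refine ⟨p.map (SimpleGraph.Embedding.induce S).toHom, fun x y h => ?_⟩
  obtain ⟨e, -, he⟩ : ∃ e ∈ p.edges,
      e.map (SimpleGraph.Embedding.induce (G := G) S).toHom = s(x, y) := by
    have h' := p.edges_map (SimpleGraph.Embedding.induce (G := G) S).toHom
    exact List.mem_map.1 (h' ▸ h)
  induction e with
  | _ u v =>
    rw [Sym2.map_mk, Sym2.eq_iff] at he
    rcases he with ⟨rfl, rfl⟩ | ⟨rfl, rfl⟩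
    · exact ⟨u.2, v.2⟩
    · exact ⟨v.2, u.2⟩

theorem IsSubtree.union {S T : Set V} (hS : IsSubtree G S) (hT : IsSubtree G T)
    (h : (S ∩ T).Nonempty) : IsSubtree G (S ∪ T) := by
  obtain ⟨m, hmS, hmT⟩ := h
  have key : ∀ a ∈ S, ∀ b ∈ T, ∀ C : G.Subgraph, IsCycleOf G C → ¬ C.Adj a b := by
    intro a ha b hb C hC
    obtain ⟨p, hp⟩ := hS.exists_walk ha hmS
    obtain ⟨q, hq⟩ := hT.exists_walk hmT hb
    refine not_adj_of_walk (p.append q) (fun x y hxy C' hC' => ?_) hC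
    rw [SimpleGraph.Walk.edges_append, List.mem_append] at hxy
    rcases hxy with hxy | hxy
    · exact hS.edges x (hp x y hxy).1 y (hp x y hxy).2 C' hC'
    · exact hT.edges x (hq x y hxy).1 y (hq x y hxy).2 C' hC'
  have hedges : ∀ u ∈ S ∪ T, ∀ v ∈ S ∪ T, ∀ C : G.Subgraph, IsCycleOf G C → ¬ C.Adj u v := by
    rintro a (ha | ha) b (hb | hb) C hC
    · exact hS.edges a ha b hb C hC
    · exact key a ha b hb C hC
    · exact fun h => key b hb a ha C hC h.symm
    · exact hT.edges a ha b hb C hC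
  refine ⟨?_, ⟨?_, ?_⟩, hedges⟩
  · rintro v (hv | hv)
    · exact hS.vertices v hv
    · exact hT.vertices v hv
  · exact SimpleGraph.induce_union_connected hS.tree.connected.preconnected
      hT.tree.connected.preconnected ⟨m, hmS, hmT⟩
  · intro v p hp
    -- A cycle of the induced graph would be a cycle of `G` with its edges in `S ∪ T`.
    have hp' := hp.map (f := (SimpleGraph.Embedding.induce (G := G) (S ∪ T)).toHom)
      (SimpleGraph.Embedding.induce (G := G) (S ∪ T)).injective
    cases p with
    | nil => exact SimpleGraph.Walk.not_isCycle_nil hp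
    | @cons _ c _ h q =>
      refine hedges v v.2 c c.2 _ ⟨_, _, hp', rfl⟩ ?_
      rw [SimpleGraph.Walk.adj_toSubgraph_iff_mem_edges]
      exact List.mem_cons_self

end

variable {V : Type*} [Fintype V] {G : SimpleGraph V} {D : DFSData G}

theorem IsCycleOf.exists_tree_edge (hG : IsCactus G) (D : DFSData G) {C : G.Subgraph}
    (hC : IsCycleOf G C) : ∃ v, (D.dfn v : ℕ) ≠ 0 ∧ C.Adj v (D.father v) := by
  obtain ⟨u, hu, hmax⟩ : ∃ u ∈ C.verts, ∀ y ∈ C.verts, D.dfn y ≤ D.dfn u := by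
    obtain ⟨v, p, -, rfl⟩ := hC
    exact Set.exists_max_image _ D.dfn (Set.toFinite _) ⟨v, p.start_mem_verts_toSubgraph⟩
  -- Of the two edges of `C` at its last vertex, at most one is a back edge.
  have h2 : (C.neighborSet u).ncard = 2 := by
    obtain ⟨v, p, hp, rfl⟩ := hC
    exact hp.ncard_neighborSet_toSubgraph_eq_two (by simpa using hu)
  obtain ⟨a, b, hab, hN⟩ := Set.ncard_eq_two.1 h2
  have hlt : ∀ x, C.Adj u x → (D.dfn x : ℕ) < D.dfn u := fun x hx =>
    (Fin.le_def.1 (hmax x hx.snd_mem)).lt_of_ne fun h => hx.ne (eq_of_dfn (D := D) h).symm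
  have ha : C.Adj u a := by
    have : a ∈ C.neighborSet u := by simp [hN]
    exact this
  have hb : C.Adj u b := by
    have : b ∈ C.neighborSet u := by simp [hN]
    exact this
  refine ⟨u, by have := hlt a ha; omega, ?_⟩
  by_cases hfa : D.father u = a
  · rwa [hfa]
  by_cases hfb : D.father u = b
  · rwa [hfb]
  exact absurd (Covers.unique hG (Back.covers ⟨ha.adj_sub, hlt a ha, hfa⟩)
    (Back.covers ⟨hb.adj_sub, hlt b hb, hfb⟩)).2 hab.symm

theorem IsGraft.exists_tree_edge (D : DFSData G) {S : Set V} (hS : IsGraft G S) :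
    ∃ v, (D.dfn v : ℕ) ≠ 0 ∧ v ∈ S ∧ D.father v ∈ S := by
  obtain ⟨x, hx, z, hz, hadj, hlt⟩ : ∃ x ∈ S, ∃ z ∈ S, G.Adj x z ∧
      (D.dfn z : ℕ) < D.dfn x := by
    obtain ⟨a, ha, b, hb, hab⟩ := hS.2
    obtain ⟨p⟩ := hS.1.prop.tree.connected.preconnected ⟨a, ha⟩ ⟨b, hb⟩
    cases p with
    | nil => exact absurd rfl hab
    | @cons _ c _ h _ =>
      have h' : G.Adj a c := h
      rcases lt_trichotomy (D.dfn a : ℕ) (D.dfn c) with h1 | h1 | h1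
      · exact ⟨c, c.2, a, ha, h'.symm, h1⟩
      · exact absurd (eq_of_dfn (D := D) h1) h'.ne
      · exact ⟨a, ha, c, c.2, h', h1⟩
  refine ⟨x, by omega, hx, ?_⟩
  by_contra hf
  obtain ⟨C, hC, -, hCa, -⟩ :=
    Back.exists_cycle (D := D) ⟨hadj, hlt, fun h => hf (h ▸ hz)⟩
  exact hS.1.prop.edges x hx z hz C hC hCa

/-- Every block contains a tree edge, and different blocks have no common edge; so there are at
most as many blocks as tree edges. -/
theorem numBlocks_lt (hG : IsCactus G) (D : DFSData G) : numBlocks G < Fintype.card V := by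
  classical
  have hex := fun (C : G.Subgraph) (hC : IsCycleOf G C) => hC.exists_tree_edge hG D
  have hex' := fun (S : Set V) (hS : IsGraft G S) => hS.exists_tree_edge D
  have hnonempty : Nonempty V := hG.connected.nonempty
  choose! f hf0 hf using hex
  choose! g hg0 hg hg' using hex'
  have hfi : Set.InjOn f {C : G.Subgraph | IsCycleOf G C} := by
    intro C hC C' hC' h
    refine IsCycleOf.eq_of_adj hG hC hC' (hf C hC) ?_
    rw [h]
    exact hf C' hC'
  have hgi : Set.InjOn g {S : Set V | IsGraft G S} := by
    intro S hS S' hS' h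
    have hU := hS.1.prop.union hS'.1.prop ⟨g S, hg S hS, h ▸ hg S' hS'⟩
    exact Set.Subset.antisymm
      (Set.subset_union_left.trans (hS'.1.le_of_ge hU Set.subset_union_right))
      (Set.subset_union_right.trans (hS.1.le_of_ge hU Set.subset_union_left))
  have hdisj : Disjoint (f '' {C : G.Subgraph | IsCycleOf G C}) (g '' {S : Set V | IsGraft G S}) := by
    rw [Set.disjoint_left]
    rintro _ ⟨C, hC, rfl⟩ ⟨S, hS, h⟩
    refine hS.1.prop.edges _ (hg S hS) _ (hg' S hS) C hC ?_
    rw [h]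
    exact hf C hC
  rw [numBlocks, ← hfi.ncard_image, ← hgi.ncard_image,
    ← Set.ncard_union_eq hdisj (Set.toFinite _) (Set.toFinite _), ← Nat.card_eq_fintype_card]
  refine Set.ncard_lt_card fun huniv => ?_
  have hs : D.dfn.symm ⟨0, Fintype.card_pos⟩ ∈ (Set.univ : Set V) := Set.mem_univ _
  rw [← huniv] at hs
  rcases hs with ⟨C, hC, h⟩ | ⟨S, hS, h⟩
  · exact hf0 C hC (by rw [h, Equiv.apply_symm_apply])
  · exact hg0 S hS (by rw [h, Equiv.apply_symm_apply])

end Cactus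

namespace Cactus

/-! ### Sets of minimum weight -/

section

variable {V : Type*} {w : V → ℝ} {P Q : Finset V → Prop} {p q : EReal}

/-- `c` is the minimum weight of the finite sets with the property `P`, and `∞` if there are no
such sets. -/
structure IsMinWeight (w : V → ℝ) (P : Finset V → Prop) (c : EReal) : Prop where
  le : ∀ A, P A → c ≤ ((∑ v ∈ A, w v : ℝ) : EReal)
  attained : c = ⊤ ∨ ∃ A, P A ∧ ((∑ v ∈ A, w v : ℝ) : EReal) = c

/-- `A` is the union of a set with the property `P` and a set with the property `Q`. -/
def IsJoin (P Q : Finset V → Prop) (A : Finset V) : Prop :=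
  ∃ B C, P B ∧ Q C ∧ ∀ x, x ∈ A ↔ x ∈ B ∨ x ∈ C

namespace IsMinWeight

theorem congr (h : IsMinWeight w P p) (hPQ : ∀ A, Q A ↔ P A) : IsMinWeight w Q p := by
  obtain rfl : Q = P := funext fun A => propext (hPQ A)
  exact h

theorem ne_bot (h : IsMinWeight w P p) : p ≠ ⊥ := by
  rcases h.attained with rfl | ⟨A, -, rfl⟩
  · exact top_ne_bot
  · exact EReal.coe_ne_bot _

theorem or (hp : IsMinWeight w P p) (hq : IsMinWeight w Q q) :
    IsMinWeight w (fun A => P A ∨ Q A) (p ⊓ q) := by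
  refine ⟨?_, ?_⟩
  · rintro A (h | h)
    · exact inf_le_left.trans (hp.le A h)
    · exact inf_le_right.trans (hq.le A h)
  · rcases min_choice p q with h | h <;> rw [h]
    · exact hp.attained.imp_right fun ⟨A, hA, h⟩ => ⟨A, .inl hA, h⟩
    · exact hq.attained.imp_right fun ⟨A, hA, h⟩ => ⟨A, .inr hA, h⟩

theorem join (hp : IsMinWeight w P p) (hq : IsMinWeight w Q q)
    (hPQ : ∀ A B, P A → Q B → Disjoint A B) : IsMinWeight w (IsJoin P Q) (p + q) := by
  classical
  have key : ∀ A B C, P B → Q C → (∀ x, x ∈ A ↔ x ∈ B ∨ x ∈ C) →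
      ((∑ v ∈ A, w v : ℝ) : EReal) = ((∑ v ∈ B, w v : ℝ) : EReal) + (∑ v ∈ C, w v : ℝ) := by
    intro A B C hB hC hA
    obtain rfl : A = B ∪ C := by
      ext x
      rw [hA, Finset.mem_union]
    rw [Finset.sum_union (hPQ B C hB hC), EReal.coe_add]
  refine ⟨?_, ?_⟩
  · rintro A ⟨B, C, hB, hC, hA⟩
    rw [key A B C hB hC hA]
    exact add_le_add (hp.le B hB) (hq.le C hC)
  · rcases hp.attained with rfl | ⟨B, hB, rfl⟩
    · exact .inl (EReal.top_add_of_ne_bot hq.ne_bot)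
    rcases hq.attained with rfl | ⟨C, hC, rfl⟩
    · exact .inl (EReal.add_top_of_ne_bot hp.ne_bot)
    exact .inr ⟨B ∪ C, ⟨B, C, hB, hC, fun x => Finset.mem_union⟩,
      key _ B C hB hC fun x => Finset.mem_union⟩

theorem of_iff_eq {A : Finset V} (h : ∀ B, P B ↔ B = A) :
    IsMinWeight w P ((∑ v ∈ A, w v : ℝ) : EReal) :=
  ⟨fun B hB => by rw [(h B).1 hB], .inr ⟨A, (h A).2 rfl, rfl⟩⟩

theorem of_not (h : ∀ B, ¬ P B) : IsMinWeight w P ⊤ :=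
  ⟨fun B hB => absurd hB (h B), .inl rfl⟩

theorem eq_weightedDominationNumber [Fintype V] {G : SimpleGraph V}
    (h : IsMinWeight w (IsDominating G) p) : p = weightedDominationNumber G w := by
  classical
  have hle : ∀ A, IsDominating G A → weightedDominationNumber G w ≤ ∑ v ∈ A, w v := fun A hA =>
    Finset.inf'_le _ (Finset.mem_filter.2 ⟨Finset.mem_univ _, hA⟩)
  apply le_antisymm
  · obtain ⟨A, hA, h'⟩ := Finset.exists_mem_eq_inf'
      (s := Finset.univ.filter fun D : Finset V => IsDominating G D)
      ⟨Finset.univ, Finset.mem_filter.2 ⟨Finset.mem_univ _, isDominating_univ G⟩⟩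
      (fun D => ∑ v ∈ D, w v)
    have h'' : weightedDominationNumber G w = ∑ v ∈ A, w v := h'
    rw [h'']
    exact h.le A (Finset.mem_filter.1 hA).2
  · rcases h.attained with rfl | ⟨A, hA, rfl⟩
    · exact le_top
    · exact EReal.coe_le_coe_iff.2 (hle A hA)

end IsMinWeight

end

/-! ### The recursion for partial dominating sets -/

variable {V : Type*}

/-- `y` belongs to `A` or has a neighbour in `A`. -/
def DominatesAt (G : SimpleGraph V) (A : Finset V) (y : V) : Prop :=
  y ∈ A ∨ ∃ x ∈ A, G.Adj x y

variable [Fintype V] {G : SimpleGraph V}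

/-- There is a back edge from `y` to a vertex visited before `v`. -/
def DFSData.Exposed (D : DFSData G) (v y : V) : Prop := ∃ z, D.Back y z ∧ D.dfn z < D.dfn v

/-- `A` is a subset of the part `S` with top `v` that dominates `S` except perhaps `v`, where the
mode `s` tells how the exposed vertices are treated: for `s = 0` they count as dominated, for
`s = 2` they have to be in `A`, and for other values, `s = 1` say, they are ordinary vertices. -/
structure Feasible (D : DFSData G) (S : V → Prop) (s : ℕ) (v : V) (A : Finset V) : Prop where
  sub : ∀ x ∈ A, S x
  dom : ∀ y, S y → y ≠ v → DominatesAt G A y ∨ (s = 0 ∧ D.Exposed v y)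
  forced : s = 2 → ∀ y, S y → D.Exposed v y → y ∈ A

/-- The three values kept for the part `S` with top `v` in the mode `s`, namely the minimum weights
of the feasible sets that contain `v`, that omit `v` and dominate it, and that omit `v`. -/
structure IsTable (D : DFSData G) (w : V → ℝ) (S : V → Prop) (s : ℕ) (v : V) (a b c : EReal) :
    Prop where
  mem : IsMinWeight w (fun A => Feasible D S s v A ∧ v ∈ A) a
  notMem_dom : IsMinWeight w (fun A => Feasible D S s v A ∧ v ∉ A ∧
    (DominatesAt G A v ∨ (s = 0 ∧ D.Exposed v v))) b
  notMem : IsMinWeight w (fun A => Feasible D S s v A ∧ v ∉ A) c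

/-- `A` is a subset of the part `S` that can be the intersection of `S` with a feasible set for a
part with top `v` that contains `S` and where `v` is not in `S`; the proposition `t` tells whether
`v` belongs to the larger set. -/
structure Hangs (D : DFSData G) (S : V → Prop) (s : ℕ) (v : V) (t : Prop) (A : Finset V) :
    Prop where
  sub : ∀ x ∈ A, S x
  dom : ∀ y, S y → DominatesAt G A y ∨ (t ∧ G.Adj v y) ∨ (s = 0 ∧ D.Exposed v y)
  forced : s = 2 → ∀ y, S y → D.Exposed v y → y ∈ A

variable {D : DFSData G} {w : V → ℝ} {k s : ℕ} {u v x y : V}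

namespace DFSData

theorem ne_father (hk : (D.dfn u : ℕ) = k) (hk0 : k ≠ 0) : D.father u ≠ u := fun h => by
  have := father_dfn_lt (D := D) (v := u) (by omega)
  rw [h] at this
  exact this.false

theorem Part.not_both (hk : (D.dfn u : ℕ) = k) (hk0 : k ≠ 0)
    (hx : D.Part (k + 1) (D.father u) x) (hx' : D.Part (k + 1) u x) : False :=
  ne_father hk hk0 (Part.unique ((father_dfn_le D u).trans_lt (by omega)) (by omega) hx hx')

/-- The edges between a part and the part of a son of its top end in the top. -/
theorem Part.eq_father_of_adj (hk : (D.dfn u : ℕ) = k) (hk0 : k ≠ 0) (h : G.Adj x y)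
    (hx : D.Part (k + 1) (D.father u) x) (hy : D.Part (k + 1) u y) : x = D.father u := by
  subst hk
  have hxu : ¬ D.Anc u x := fun h => Part.not_both rfl hk0 hx (Part.iff_anc.2 h)
  rcases eq_or_covers_of_adj h.symm (Part.iff_anc.1 hy) hxu with ⟨-, h⟩ | h
  · exact h
  · exact eq_of_dfn (D := D) (le_antisymm h.anc_father.dfn_le hx.dfn_le)

end DFSData

open DFSData

theorem Feasible.iff_of_union (hk : (D.dfn u : ℕ) = k) (hk0 : k ≠ 0) {A B C : Finset V}
    (hB : ∀ x ∈ B, D.Part (k + 1) (D.father u) x) (hC : ∀ x ∈ C, D.Part (k + 1) u x)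
    (hA : ∀ x, x ∈ A ↔ x ∈ B ∨ x ∈ C) :
    Feasible D (D.Part k (D.father u)) s (D.father u) A ↔
      Feasible D (D.Part (k + 1) (D.father u)) s (D.father u) B ∧
      Hangs D (D.Part (k + 1) u) s (D.father u) (D.father u ∈ B) C := by
  have hpart : ∀ x, D.Part k (D.father u) x ↔
      D.Part (k + 1) (D.father u) x ∨ D.Part (k + 1) u x := fun x => by
    rw [Part.iff_succ hk hk0]
    simp
  have hB' : ∀ x, D.Part (k + 1) (D.father u) x → (x ∈ A ↔ x ∈ B) := fun x hx => by
    rw [hA, or_iff_left fun h => Part.not_both hk hk0 hx (hC x h)]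
  have hC' : ∀ x, D.Part (k + 1) u x → (x ∈ A ↔ x ∈ C) := fun x hx => by
    rw [hA, or_iff_right fun h => Part.not_both hk hk0 (hB x h) hx]
  have hdB : ∀ y, D.Part (k + 1) (D.father u) y → y ≠ D.father u →
      (DominatesAt G A y ↔ DominatesAt G B y) := fun y hy hne => by
    refine or_congr (hB' y hy) ⟨fun ⟨x, hx, h⟩ => ?_, fun ⟨x, hx, h⟩ => ⟨x, (hA x).2 (.inl hx), h⟩⟩
    rcases (hA x).1 hx with hx | hx
    · exact ⟨x, hx, h⟩
    · exact absurd (Part.eq_father_of_adj hk hk0 h.symm hy (hC x hx)) hne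
  have hdC : ∀ y, D.Part (k + 1) u y → (DominatesAt G A y ↔
      DominatesAt G C y ∨ (D.father u ∈ B ∧ G.Adj (D.father u) y)) := fun y hy => by
    rw [DominatesAt, DominatesAt, or_assoc]
    refine or_congr (hC' y hy) ⟨fun ⟨x, hx, h⟩ => ?_, ?_⟩
    · rcases (hA x).1 hx with hx | hx
      · obtain rfl := Part.eq_father_of_adj hk hk0 h (hB x hx) hy
        exact .inr ⟨hx, h⟩
      · exact .inl ⟨x, hx, h⟩
    · rintro (⟨x, hx, h⟩ | ⟨hx, h⟩)
      · exact ⟨x, (hA x).2 (.inr hx), h⟩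
      · exact ⟨_, (hA _).2 (.inl hx), h⟩
  constructor
  · rintro ⟨-, h2, h3⟩
    refine ⟨⟨hB, fun y hy hne => ?_, fun hs y hy he => ?_⟩, hC, fun y hy => ?_, fun hs y hy he => ?_⟩
    · rw [← hdB y hy hne]
      exact h2 y ((hpart y).2 (.inl hy)) hne
    · exact (hB' y hy).1 (h3 hs y ((hpart y).2 (.inl hy)) he)
    · rw [← or_assoc, ← hdC y hy]
      refine h2 y ((hpart y).2 (.inr hy)) ?_
      rintro rfl
      exact Part.not_both hk hk0 .refl hy
    · exact (hC' y hy).1 (h3 hs y ((hpart y).2 (.inr hy)) he)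
  · rintro ⟨⟨-, h2, h3⟩, ⟨-, h4, h5⟩⟩
    refine ⟨fun x hx => (hpart x).2 (((hA x).1 hx).imp (hB x) (hC x)), fun y hy hne => ?_,
      fun hs y hy he => ?_⟩
    · rcases (hpart y).1 hy with hy | hy
      · rw [hdB y hy hne]
        exact h2 y hy hne
      · rw [hdC y hy, or_assoc]
        exact h4 y hy
    · rcases (hpart y).1 hy with hy | hy
      · exact (hB' y hy).2 (h3 hs y hy he)
      · exact (hC' y hy).2 (h5 hs y hy he)

theorem exists_split (hk : (D.dfn u : ℕ) = k) (hk0 : k ≠ 0) {A : Finset V}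
    (h : Feasible D (D.Part k (D.father u)) s (D.father u) A) : ∃ B C : Finset V,
    (∀ x ∈ B, D.Part (k + 1) (D.father u) x) ∧ (∀ x ∈ C, D.Part (k + 1) u x) ∧
    ∀ x, x ∈ A ↔ x ∈ B ∨ x ∈ C := by
  classical
  refine ⟨A.filter (D.Part (k + 1) (D.father u)), A.filter (D.Part (k + 1) u),
    fun x hx => (Finset.mem_filter.1 hx).2, fun x hx => (Finset.mem_filter.1 hx).2, fun x => ?_⟩
  rw [Finset.mem_filter, Finset.mem_filter, ← and_or_left]
  refine ⟨fun hx => ⟨hx, ?_⟩, And.left⟩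
  simpa using (Part.iff_succ hk hk0).1 (h.sub x hx)

/-- The values for the part of a vertex after a son has been joined to it. -/
theorem IsTable.join (hk : (D.dfn u : ℕ) = k) (hk0 : k ≠ 0) {a b c ta tb tc : EReal}
    (h : IsTable D w (D.Part (k + 1) (D.father u)) s (D.father u) a b c)
    (ha : IsMinWeight w (fun A => Hangs D (D.Part (k + 1) u) s (D.father u) False A ∧
      ∃ x ∈ A, G.Adj x (D.father u)) ta)
    (hb : IsMinWeight w (Hangs D (D.Part (k + 1) u) s (D.father u) False) tb)
    (hc : IsMinWeight w (Hangs D (D.Part (k + 1) u) s (D.father u) True) tc) :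
    IsTable D w (D.Part k (D.father u)) s (D.father u) (a + tc) ((b + tb) ⊓ (c + ta))
      (c + tb) := by
  have hdis : ∀ B C : Finset V, (∀ x ∈ B, D.Part (k + 1) (D.father u) x) →
      (∀ x ∈ C, D.Part (k + 1) u x) → Disjoint B C := fun B C hB hC =>
    Finset.disjoint_left.2 fun x hx hx' => Part.not_both hk hk0 (hB x hx) (hC x hx')
  have hmem : ∀ {A B C : Finset V}, (∀ x ∈ C, D.Part (k + 1) u x) →
      (∀ x, x ∈ A ↔ x ∈ B ∨ x ∈ C) → (D.father u ∈ A ↔ D.father u ∈ B) := fun hC hA => by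
    rw [hA, or_iff_left fun h => Part.not_both hk hk0 .refl (hC _ h)]
  have hdom : ∀ {A B C : Finset V}, (∀ x ∈ C, D.Part (k + 1) u x) →
      (∀ x, x ∈ A ↔ x ∈ B ∨ x ∈ C) → (DominatesAt G A (D.father u) ↔
        DominatesAt G B (D.father u) ∨ ∃ x ∈ C, G.Adj x (D.father u)) := fun hC hA => by
    rw [DominatesAt, DominatesAt, hmem hC hA, or_assoc]
    simp only [hA, or_and_right, exists_or]
  refine ⟨(h.mem.join hc ?_).congr fun A => ⟨?_, ?_⟩,
    ((h.notMem_dom.join hb ?_).or (h.notMem.join ha ?_)).congr fun A => ⟨?_, ?_⟩,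
    (h.notMem.join hb ?_).congr fun A => ⟨?_, ?_⟩⟩
  · exact fun B C hB hC => hdis B C hB.1.sub hC.sub
  · rintro ⟨hf, hv⟩
    obtain ⟨B, C, hB, hC, hA⟩ := exists_split hk hk0 hf
    rw [hmem hC hA] at hv
    rw [Feasible.iff_of_union hk hk0 hB hC hA, eq_true hv] at hf
    exact ⟨B, C, ⟨hf.1, hv⟩, hf.2, hA⟩
  · rintro ⟨B, C, ⟨hB, hv⟩, hC, hA⟩
    refine ⟨?_, (hmem hC.sub hA).2 hv⟩
    rw [Feasible.iff_of_union hk hk0 hB.sub hC.sub hA, eq_true hv]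
    exact ⟨hB, hC⟩
  · exact fun B C hB hC => hdis B C hB.1.sub hC.sub
  · exact fun B C hB hC => hdis B C hB.1.sub hC.1.sub
  · rintro ⟨hf, hv, hd⟩
    obtain ⟨B, C, hB, hC, hA⟩ := exists_split hk hk0 hf
    rw [hmem hC hA] at hv
    rw [Feasible.iff_of_union hk hk0 hB hC hA, eq_false hv] at hf
    rw [hdom hC hA, or_right_comm] at hd
    rcases hd with hd | hd
    · exact .inl ⟨B, C, ⟨hf.1, hv, hd⟩, hf.2, hA⟩
    · exact .inr ⟨B, C, ⟨hf.1, hv⟩, ⟨hf.2, hd⟩, hA⟩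
  · rintro (⟨B, C, ⟨hB, hv, hd⟩, hC, hA⟩ | ⟨B, C, ⟨hB, hv⟩, ⟨hC, hd⟩, hA⟩)
    all_goals
      rw [Feasible.iff_of_union hk hk0 hB.sub hC.sub hA, hmem hC.sub hA, hdom hC.sub hA,
        eq_false hv, or_right_comm]
      exact ⟨⟨hB, hC⟩, not_false, by tauto⟩
  · exact fun B C hB hC => hdis B C hB.1.sub hC.sub
  · rintro ⟨hf, hv⟩
    obtain ⟨B, C, hB, hC, hA⟩ := exists_split hk hk0 hf
    rw [hmem hC hA] at hv
    rw [Feasible.iff_of_union hk hk0 hB hC hA, eq_false hv] at hf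
    exact ⟨B, C, ⟨hf.1, hv⟩, hf.2, hA⟩
  · rintro ⟨B, C, ⟨hB, hv⟩, hC, hA⟩
    refine ⟨?_, by rwa [hmem hC.sub hA]⟩
    rw [Feasible.iff_of_union hk hk0 hB.sub hC.sub hA, eq_false hv]
    exact ⟨hB, hC⟩

theorem IsTable.of_ne (hk : (D.dfn u : ℕ) = k) (hk0 : k ≠ 0) (hv : v ≠ D.father u)
    {a b c : EReal} (h : IsTable D w (D.Part (k + 1) v) s v a b c) :
    IsTable D w (D.Part k v) s v a b c := by
  have : D.Part k v = D.Part (k + 1) v := by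
    funext x
    rw [Part.iff_succ hk hk0]
    simp [hv]
  rwa [this]

/-! ### The contribution of a son -/

/-- If `u` is not the first vertex after the top of a cycle, then only `u` among its descendants
is a neighbour of the father of `u`, and the exposed vertices remain so. -/
theorem exposed_father_iff (hk : (D.dfn u : ℕ) = k) (hk0 : k ≠ 0)
    (hr : D.root u ≠ D.father u) (hy : D.Part (k + 1) u y) :
    (G.Adj (D.father u) y ↔ y = u) ∧ (D.Exposed (D.father u) y ↔ D.Exposed u y) := by
  have hlt : (D.dfn (D.father u) : ℕ) < D.dfn u := father_dfn_lt (by omega)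
  subst hk
  have hanc := Part.iff_anc.1 hy
  refine ⟨⟨fun h => ?_, ?_⟩, ⟨fun ⟨z, hz, h⟩ => ⟨z, hz, ?_⟩, fun ⟨z, hz, h⟩ => ⟨z, hz, ?_⟩⟩⟩
  · refine ((eq_or_covers_of_adj h.symm hanc fun h => ?_).resolve_right
      fun h => hr h.root_eq).1
    have := h.dfn_le
    omega
  · rintro rfl
    exact D.father_adj y hk0
  · exact h.trans (Fin.lt_def.2 hlt)
  · have hc : D.Covers y z u := ⟨hz, hanc, Fin.lt_def.1 h⟩
    refine Fin.lt_def.2 (hc.anc_father.dfn_le.lt_of_ne fun h' => hr ?_)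
    rw [hc.root_eq, eq_of_dfn h']

theorem Hangs.iff_of_root_ne (hk : (D.dfn u : ℕ) = k) (hk0 : k ≠ 0)
    (hr : D.root u ≠ D.father u) {t : Prop} {A : Finset V} :
    Hangs D (D.Part (k + 1) u) s (D.father u) t A ↔ Feasible D (D.Part (k + 1) u) s u A ∧
      (t ∨ DominatesAt G A u ∨ (s = 0 ∧ D.Exposed u u)) := by
  have key := fun y (hy : D.Part (k + 1) u y) => exposed_father_iff hk hk0 hr hy
  constructor
  · rintro ⟨h1, h2, h3⟩
    refine ⟨⟨h1, fun y hy hne => ?_, fun hs y hy he => h3 hs y hy ((key y hy).2.2 he)⟩, ?_⟩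
    · have := h2 y hy
      rw [(key y hy).1, (key y hy).2] at this
      tauto
    · have := h2 u .refl
      rw [(key u .refl).1, (key u .refl).2] at this
      tauto
  · rintro ⟨⟨h1, h2, h3⟩, h4⟩
    refine ⟨h1, fun y hy => ?_, fun hs y hy he => h3 hs y hy ((key y hy).2.1 he)⟩
    rw [(key y hy).1, (key y hy).2]
    by_cases hyu : y = u
    · subst hyu
      tauto
    · have := h2 y hy hyu
      tauto

theorem exists_adj_father_iff (hk : (D.dfn u : ℕ) = k) (hk0 : k ≠ 0)
    (hr : D.root u ≠ D.father u) {A : Finset V} (hA : ∀ x ∈ A, D.Part (k + 1) u x) :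
    (∃ x ∈ A, G.Adj x (D.father u)) ↔ u ∈ A := by
  refine ⟨fun ⟨x, hx, h⟩ => ?_, fun h => ⟨u, h, (D.father_adj u (by omega)).symm⟩⟩
  rwa [← ((exposed_father_iff hk hk0 hr (hA x hx)).1).1 h.symm]

/-- If the father of `u` is the top of a cycle through `u`, then its neighbours among the
descendants of `u` are `u` and the lower end `y` of the back edge of the cycle, and this is the
only exposed descendant of `u`. -/
theorem exists_exposed (hG : IsCactus G) (hk : (D.dfn u : ℕ) = k) (hk0 : k ≠ 0)
    (hr : D.root u = D.father u) : ∃ y, D.Part (k + 1) u y ∧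
      ∀ x, D.Part (k + 1) u x → (G.Adj (D.father u) x ↔ x = u ∨ x = y) ∧
        (D.Exposed u x ↔ x = y) ∧ ¬ D.Exposed (D.father u) x := by
  have hlt : (D.dfn (D.father u) : ℕ) < D.dfn u := father_dfn_lt (by omega)
  obtain ⟨y, hy⟩ := exists_covers_of_root_ne (D := D) (u := u) (by rw [hr]; exact ne_father hk hk0)
  rw [hr] at hy
  subst hk
  refine ⟨y, Part.iff_anc.2 hy.anc, fun x hx => ?_⟩
  have hanc := Part.iff_anc.1 hx
  refine ⟨⟨fun h => ?_, ?_⟩, ⟨fun ⟨z, hz, h⟩ => ?_, ?_⟩, fun ⟨z, hz, h⟩ => ?_⟩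
  · refine (eq_or_covers_of_adj h.symm hanc fun h => ?_).imp And.left
      fun h => (Covers.unique hG hy h).1
    have := h.dfn_le
    omega
  · rintro (rfl | rfl)
    · exact D.father_adj x hk0
    · exact hy.back.adj.symm
  · exact (Covers.unique hG hy ⟨hz, hanc, h⟩).1
  · rintro rfl
    exact ⟨_, hy.back, hlt⟩
  · rw [Fin.lt_def] at h
    rw [(Covers.unique hG hy ⟨hz, hanc, h.trans hlt⟩).2] at h
    exact h.false

theorem Hangs.iff_of_root_eq (hG : IsCactus G) (hk : (D.dfn u : ℕ) = k) (hk0 : k ≠ 0)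
    (hr : D.root u = D.father u) {A : Finset V} :
    (Hangs D (D.Part (k + 1) u) s (D.father u) True A ↔
      Feasible D (D.Part (k + 1) u) 0 u A) ∧
    (Hangs D (D.Part (k + 1) u) s (D.father u) False A ↔
      Feasible D (D.Part (k + 1) u) 1 u A ∧ DominatesAt G A u) ∧
    (Hangs D (D.Part (k + 1) u) s (D.father u) False A ∧ (∃ x ∈ A, G.Adj x (D.father u)) ↔
      (Feasible D (D.Part (k + 1) u) 1 u A ∧ u ∈ A) ∨
      (Feasible D (D.Part (k + 1) u) 2 u A ∧ DominatesAt G A u)) := by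
  obtain ⟨y, hy, key⟩ := exists_exposed hG hk hk0 hr
  have hF : Hangs D (D.Part (k + 1) u) s (D.father u) False A ↔
      Feasible D (D.Part (k + 1) u) 1 u A ∧ DominatesAt G A u := by
    constructor
    · rintro ⟨h1, h2, -⟩
      have h2' : ∀ x, D.Part (k + 1) u x → DominatesAt G A x := fun x hx => by
        simpa [(key x hx).2.2] using h2 x hx
      exact ⟨⟨h1, fun x hx _ => .inl (h2' x hx), by simp⟩, h2' u .refl⟩
    · rintro ⟨⟨h1, h2, -⟩, h4⟩
      refine ⟨h1, fun x hx => .inl ?_, fun _ x hx he => absurd he (key x hx).2.2⟩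
      by_cases hxu : x = u
      · rwa [hxu]
      · exact (h2 x hx hxu).resolve_right (by simp)
  refine ⟨⟨?_, ?_⟩, hF, ?_⟩
  · rintro ⟨h1, h2, -⟩
    refine ⟨h1, fun x hx hne => ?_, by simp⟩
    have := h2 x hx
    rw [(key x hx).1] at this
    rw [(key x hx).2.1]
    have := (key x hx).2.2
    tauto
  · rintro ⟨h1, h2, -⟩
    refine ⟨h1, fun x hx => ?_, fun _ x hx he => absurd he (key x hx).2.2⟩
    have := h2 x hx
    rw [(key x hx).1]
    rw [(key x hx).2.1] at this
    tauto
  · have hadj : (∀ x ∈ A, D.Part (k + 1) u x) →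
        ((∃ x ∈ A, G.Adj x (D.father u)) ↔ u ∈ A ∨ y ∈ A) := by
      intro h1
      constructor
      · rintro ⟨x, hx, h⟩
        rcases (key x (h1 x hx)).1.1 h.symm with rfl | rfl
        · exact .inl hx
        · exact .inr hx
      · rintro (h | h)
        · exact ⟨u, h, ((key u .refl).1.2 (.inl rfl)).symm⟩
        · exact ⟨y, h, ((key y hy).1.2 (.inr rfl)).symm⟩
    -- Mode 2 amounts to mode 1 together with `y ∈ A`.
    have h12 : Feasible D (D.Part (k + 1) u) 2 u A ↔
        Feasible D (D.Part (k + 1) u) 1 u A ∧ y ∈ A := by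
      constructor
      · rintro ⟨h1, h2, h3⟩
        exact ⟨⟨h1, by simpa using h2, by simp⟩, h3 rfl y hy ((key y hy).2.1.2 rfl)⟩
      · rintro ⟨⟨h1, h2, -⟩, h3⟩
        refine ⟨h1, by simpa using h2, fun _ x hx he => ?_⟩
        rwa [(key x hx).2.1.1 he]
    rw [hF, h12]
    constructor
    · rintro ⟨⟨h1, h2⟩, h3⟩
      rw [hadj h1.sub] at h3
      tauto
    · rintro (⟨h1, h2⟩ | ⟨⟨h1, h2⟩, h3⟩)
      · exact ⟨⟨h1, .inl h2⟩, (hadj h1.sub).2 (.inl h2)⟩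
      · exact ⟨⟨h1, h3⟩, (hadj h1.sub).2 (.inr h2)⟩

/-- Joining a son that is not the first vertex after the top of a cycle. -/
theorem IsTable.join_of_root_ne (hk : (D.dfn u : ℕ) = k) (hk0 : k ≠ 0)
    (hr : D.root u ≠ D.father u) {a b c a' b' c' : EReal}
    (h : IsTable D w (D.Part (k + 1) (D.father u)) s (D.father u) a b c)
    (h' : IsTable D w (D.Part (k + 1) u) s u a' b' c') :
    IsTable D w (D.Part k (D.father u)) s (D.father u) (a + a' ⊓ c')
      ((b + a' ⊓ b') ⊓ (c + a')) (c + a' ⊓ b') := by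
  refine h.join hk hk0 (h'.mem.congr fun A => ?_) ((h'.mem.or h'.notMem_dom).congr fun A => ?_)
    ((h'.mem.or h'.notMem).congr fun A => ?_)
  · constructor
    · rintro ⟨h1, h2⟩
      rw [exists_adj_father_iff hk hk0 hr h1.sub] at h2
      exact ⟨((Hangs.iff_of_root_ne hk hk0 hr).1 h1).1, h2⟩
    · rintro ⟨h1, h2⟩
      exact ⟨(Hangs.iff_of_root_ne hk hk0 hr).2 ⟨h1, .inr (.inl (.inl h2))⟩,
        (exists_adj_father_iff hk hk0 hr h1.sub).2 h2⟩
  · rw [Hangs.iff_of_root_ne hk hk0 hr]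
    have : u ∈ A → DominatesAt G A u := .inl
    tauto
  · rw [Hangs.iff_of_root_ne hk hk0 hr]
    tauto

/-- Joining the first vertex after the top of a cycle to this top. -/
theorem IsTable.join_of_root_eq (hG : IsCactus G) (hk : (D.dfn u : ℕ) = k) (hk0 : k ≠ 0)
    (hr : D.root u = D.father u) {a b c a₀ b₀ c₀ a₁ b₁ c₁ a₂ b₂ c₂ : EReal}
    (h : IsTable D w (D.Part (k + 1) (D.father u)) s (D.father u) a b c)
    (h₀ : IsTable D w (D.Part (k + 1) u) 0 u a₀ b₀ c₀)
    (h₁ : IsTable D w (D.Part (k + 1) u) 1 u a₁ b₁ c₁)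
    (h₂ : IsTable D w (D.Part (k + 1) u) 2 u a₂ b₂ c₂) :
    IsTable D w (D.Part k (D.father u)) s (D.father u) (a + a₀ ⊓ c₀)
      ((b + a₁ ⊓ b₁) ⊓ (c + a₁ ⊓ (a₂ ⊓ b₂))) (c + a₁ ⊓ b₁) := by
  refine h.join hk hk0 ((h₁.mem.or (h₂.mem.or h₂.notMem_dom)).congr fun A => ?_)
    ((h₁.mem.or h₁.notMem_dom).congr fun A => ?_) ((h₀.mem.or h₀.notMem).congr fun A => ?_)
  all_goals
    obtain ⟨i0, i1, i2⟩ := Hangs.iff_of_root_eq (s := s) (A := A) hG hk hk0 hr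
    have : u ∈ A → DominatesAt G A u := .inl
  · rw [i2]
    simp
    tauto
  · rw [i1]
    simp
    tauto
  · rw [i0]
    tauto

/-! ### The values at the beginning and at the end -/

open Classical in
theorem IsTable.single (D : DFSData G) (w : V → ℝ) (s : ℕ) (v : V) :
    IsTable D w (D.Part (Fintype.card V) v) s v (w v)
      (if s = 0 ∧ ∃ z, D.Back v z then 0 else ⊤) (if s = 2 ∧ ∃ z, D.Back v z then ⊤ else 0) := by
  have hS : ∀ x, D.Part (Fintype.card V) v x ↔ x = v := fun x =>
    ⟨fun h => h.eq_of_lt (D.dfn x).2, by rintro rfl; exact .refl⟩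
  have hE : D.Exposed v v ↔ ∃ z, D.Back v z :=
    ⟨fun ⟨z, hz, _⟩ => ⟨z, hz⟩, fun ⟨z, hz⟩ => ⟨z, hz, hz.lt⟩⟩
  have hF : ∀ A, Feasible D (D.Part (Fintype.card V) v) s v A ↔
      (∀ x ∈ A, x = v) ∧ (s = 2 → (∃ z, D.Back v z) → v ∈ A) := by
    intro A
    rw [← hE]
    constructor
    · rintro ⟨h1, -, h3⟩
      exact ⟨fun x hx => (hS x).1 (h1 x hx), fun hs he => h3 hs v .refl he⟩
    · rintro ⟨h1, h3⟩
      refine ⟨fun x hx => (hS x).2 (h1 x hx), fun y hy hne => absurd ((hS y).1 hy) hne,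
        fun hs y hy he => ?_⟩
      obtain rfl := (hS y).1 hy
      exact h3 hs he
  have hempty : ∀ A : Finset V, ((∀ x ∈ A, x = v) ∧ v ∉ A) ↔ A = ∅ := by
    intro A
    rw [Finset.eq_empty_iff_forall_notMem]
    exact ⟨fun ⟨h1, h2⟩ x hx => h2 (h1 x hx ▸ hx), fun h => ⟨fun x hx => absurd hx (h x), h v⟩⟩
  refine ⟨?_, ?_, ?_⟩
  · have : IsMinWeight w (fun A => Feasible D (D.Part (Fintype.card V) v) s v A ∧ v ∈ A)
        ((∑ x ∈ {v}, w x : ℝ) : EReal) := .of_iff_eq fun A => by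
      rw [hF, Finset.eq_singleton_iff_unique_mem]
      tauto
    rwa [Finset.sum_singleton] at this
  · rw [hE]
    have hd : ∀ A, Feasible D (D.Part (Fintype.card V) v) s v A → v ∉ A → ¬ DominatesAt G A v := by
      rintro A hA hv (h | ⟨x, hx, -⟩)
      · exact hv h
      · exact hv (((hF A).1 hA).1 x hx ▸ hx)
    split_ifs with h
    · have : IsMinWeight w (fun A => Feasible D (D.Part (Fintype.card V) v) s v A ∧ v ∉ A ∧
          (DominatesAt G A v ∨ (s = 0 ∧ ∃ z, D.Back v z))) ((∑ x ∈ ∅, w x : ℝ) : EReal) :=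
        .of_iff_eq fun A => by
          rw [hF, ← hempty A]
          have : s ≠ 2 := by omega
          tauto
      simpa using this
    · exact .of_not fun A ⟨h1, h2, h3⟩ => h3.elim (hd A h1 h2) h
  · split_ifs with h
    · refine .of_not fun A ⟨h1, h2⟩ => ?_
      rw [hF] at h1
      tauto
    · have : IsMinWeight w (fun A => Feasible D (D.Part (Fintype.card V) v) s v A ∧ v ∉ A)
          ((∑ x ∈ ∅, w x : ℝ) : EReal) :=
        .of_iff_eq fun A => by
          rw [hF, ← hempty A]
          tauto
      simpa using this

theorem DFSData.part_one (h0 : (D.dfn v : ℕ) = 0) (x : V) : D.Part 1 v x := by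
  suffices H : ∀ m, ∀ x, (D.dfn x : ℕ) = m → D.Part 1 v x from H _ x rfl
  intro m
  induction m using Nat.strong_induction_on with
  | _ m ih =>
    rintro x rfl
    by_cases hx : (D.dfn x : ℕ) = 0
    · obtain rfl : x = v := eq_of_dfn (D := D) (by omega)
      exact .refl
    · exact .step (by omega) (ih _ (father_dfn_lt hx) _ rfl)

theorem IsTable.inf_eq (h0 : (D.dfn v : ℕ) = 0) {a b c : EReal}
    (h : IsTable D w (D.Part 1 v) 1 v a b c) : a ⊓ b = weightedDominationNumber G w := by
  refine ((h.mem.or h.notMem_dom).congr fun A => ?_).eq_weightedDominationNumber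
  constructor
  · intro hA
    have hf : Feasible D (D.Part 1 v) 1 v A :=
      ⟨fun x _ => part_one h0 x, fun y _ _ => .inl (hA y), by simp⟩
    have := hA v
    by_cases hv : v ∈ A
    · exact .inl ⟨hf, hv⟩
    · exact .inr ⟨hf, hv, .inl this⟩
  · intro hA y
    by_cases hy : y = v
    · subst hy
      rcases hA with ⟨-, h⟩ | ⟨-, -, h⟩
      · exact .inl h
      · exact h.resolve_right (by simp)
    · have hf : Feasible D (D.Part 1 v) 1 v A := by tauto
      exact (hf.dom y (part_one h0 y) hy).resolve_right (by simp)

end Cactus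

namespace Cactus

/-! ### The program

Register 1 is the loop variable. Register 2 holds a vertex and register 3 its father. The index
array 4 marks the vertices below which a cycle continues. For each mode `s`, the value arrays
`2 + s`, `5 + s`, `8 + s` hold the three values of the parts, and position 0 of the value arrays
`11 + s`, `14 + s`, `17 + s` the contribution of the son that is being joined to its father. -/

namespace Prog

/-- Marks the father of every vertex that is on a cycle with its father, unless this father is the
top of the cycle. -/
def mark : Prog :=
  .loop 1 (.reg 0) <| .ifEq (.get 1 (.reg 1)) (.reg 1) .skip <|
    .ifEq (.get 1 (.reg 1)) (.get 0 (.reg 1)) .skip <|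
      .setIdx 4 (.get 0 (.reg 1)) (.const 1)

/-- The values of the single vertex in register 1 in mode `s`, if it is not the lower end of a
back edge. -/
def single (s : ℕ) : Prog :=
  .seq (.copy ⟨2 + s, .reg 1⟩ ⟨0, .reg 1⟩) <| .seq (.infty ⟨5 + s, .reg 1⟩) (.zero ⟨8 + s, .reg 1⟩)

/-- Computes the values of the single vertices. -/
def start : Prog :=
  .loop 1 (.reg 0) <| .seq (single 0) <| .seq (single 1) <| .seq (single 2) <|
    .ifEq (.get 1 (.reg 1)) (.reg 1) .skip <|
      .ifEq (.get 4 (.reg 1)) (.const 0)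
        (.seq (.zero ⟨5, .reg 1⟩) (.infty ⟨10, .reg 1⟩)) .skip

/-- The contribution, in mode `s`, of a vertex that has no common cycle with its father, or whose
father is not the top of their cycle. -/
def inner (s : ℕ) : Prog :=
  .seq (.copy ⟨11 + s, .const 0⟩ ⟨2 + s, .reg 2⟩) <|
    .seq (.min ⟨14 + s, .const 0⟩ ⟨2 + s, .reg 2⟩ ⟨5 + s, .reg 2⟩)
      (.min ⟨17 + s, .const 0⟩ ⟨2 + s, .reg 2⟩ ⟨8 + s, .reg 2⟩)

/-- Copies the contribution in mode 0 to mode `s`. -/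
def duplicate (s : ℕ) : Prog :=
  .seq (.copy ⟨11 + s, .const 0⟩ ⟨11, .const 0⟩) <|
    .seq (.copy ⟨14 + s, .const 0⟩ ⟨14, .const 0⟩) (.copy ⟨17 + s, .const 0⟩ ⟨17, .const 0⟩)

/-- The contribution of a vertex whose father is the top of their cycle. -/
def outer : Prog :=
  .seq (.min ⟨11, .const 0⟩ ⟨4, .reg 2⟩ ⟨7, .reg 2⟩) <|
    .seq (.min ⟨11, .const 0⟩ ⟨3, .reg 2⟩ ⟨11, .const 0⟩) <|
      .seq (.min ⟨14, .const 0⟩ ⟨3, .reg 2⟩ ⟨6, .reg 2⟩) <|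
        .seq (.min ⟨17, .const 0⟩ ⟨2, .reg 2⟩ ⟨8, .reg 2⟩) <| .seq (duplicate 1) (duplicate 2)

/-- Adds the contribution of a son to the values of its father in mode `s`. -/
def join (s : ℕ) : Prog :=
  .seq (.add ⟨20, .const 0⟩ ⟨8 + s, .reg 3⟩ ⟨11 + s, .const 0⟩) <|
    .seq (.add ⟨5 + s, .reg 3⟩ ⟨5 + s, .reg 3⟩ ⟨14 + s, .const 0⟩) <|
      .seq (.min ⟨5 + s, .reg 3⟩ ⟨5 + s, .reg 3⟩ ⟨20, .const 0⟩) <|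
        .seq (.add ⟨2 + s, .reg 3⟩ ⟨2 + s, .reg 3⟩ ⟨17 + s, .const 0⟩)
          (.add ⟨8 + s, .reg 3⟩ ⟨8 + s, .reg 3⟩ ⟨14 + s, .const 0⟩)

/-- The contribution of the vertex in register 2 to its father in register 3. -/
def contribute : Prog :=
  .ifEq (.get 1 (.reg 2)) (.reg 3) outer (.seq (inner 0) <| .seq (inner 1) (inner 2))

/-- Joins the vertex in register 2 to its father in register 3. -/
def joinSon : Prog :=
  .seq contribute <| .seq (join 0) <| .seq (join 1) (join 2)

/-- Joins all vertices to their fathers, in the reverse of the order of the visit. -/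
def joinAll : Prog :=
  .loop 1 (.sub (.reg 0) (.const 1)) <|
    .seq (.setReg 2 (.sub (.sub (.reg 0) (.const 1)) (.reg 1))) <|
      .seq (.setReg 3 (.get 0 (.reg 2))) joinSon

/-- The computation of the weighted domination number of a cactus. -/
def domination : Prog :=
  .seq mark <| .seq start <| .seq joinAll <| .min ⟨1, .const 0⟩ ⟨3, .const 0⟩ ⟨6, .const 0⟩

theorem loop_induct {x : ℕ} {e : IExp} {P : Prog} (I : ℕ → State → Prop) {s : State}
    (h0 : I 0 s) (hstep : ∀ i < e.eval s, ∀ t, I i t → I (i + 1) (P.run (t.setReg x i))) :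
    I (e.eval s) ((loop x e P).run s) := by
  rw [run]
  generalize e.eval s = n at hstep
  induction n with
  | zero => exact h0
  | succ n ih =>
    rw [List.range_succ, List.foldl_append]
    exact hstep n n.lt_succ_self _ (ih fun i hi => hstep i (hi.trans n.lt_succ_self))

/-- The contribution of the vertex in register 2 to its father in mode `s`: the minimum weights of
the sets that dominate the part of the vertex and contain a neighbour of the father, that dominate
this part, and that dominate this part if the father belongs to the dominating set. -/
noncomputable def contribution (t : State) (s : ℕ) : EReal × EReal × EReal :=
  let u := t.reg 2
  if t.idx 1 u = t.reg 3 then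
    (t.val 3 u ⊓ (t.val 4 u ⊓ t.val 7 u), t.val 3 u ⊓ t.val 6 u, t.val 2 u ⊓ t.val 8 u)
  else (t.val (2 + s) u, t.val (2 + s) u ⊓ t.val (5 + s) u, t.val (2 + s) u ⊓ t.val (8 + s) u)

theorem run_contribute (t : State) :
    (contribute.run t).reg = t.reg ∧ (contribute.run t).idx = t.idx ∧
    (contribute.run t).adds = t.adds ∧ (contribute.run t).mins ≤ t.mins + 6 ∧
    (∀ a < 11, (contribute.run t).val a = t.val a) ∧
    ∀ s < 3, (contribute.run t).val (11 + s) 0 = (contribution t s).1 ∧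
      (contribute.run t).val (14 + s) 0 = (contribution t s).2.1 ∧
      (contribute.run t).val (17 + s) 0 = (contribution t s).2.2 := by
  by_cases h : t.idx 1 (t.reg 2) = t.reg 3
  · simp only [contribute, run, IExp.eval, h, if_true, outer, duplicate, State.setVal, VRef.eval]
    refine ⟨trivial, trivial, trivial, by omega, fun a ha => ?_, fun s hs => ?_⟩
    · interval_cases a <;> simp
    · interval_cases s <;> simp [contribution, h]
  · simp only [contribute, run, IExp.eval, h, if_false, inner, State.setVal, VRef.eval]
    refine ⟨trivial, trivial, trivial, by omega, fun a ha => ?_, fun s hs => ?_⟩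
    · interval_cases a <;> simp
    · interval_cases s <;> simp [contribution, h]

theorem run_join {s : ℕ} (hs : s < 3) (t : State) :
    ((join s).run t).reg = t.reg ∧ ((join s).run t).idx = t.idx ∧
    ((join s).run t).adds = t.adds + 4 ∧ ((join s).run t).mins = t.mins + 1 ∧
    (∀ a < 20, a ≠ 2 + s → a ≠ 5 + s → a ≠ 8 + s → ((join s).run t).val a = t.val a) ∧
    ((join s).run t).val (2 + s) = Function.update (t.val (2 + s)) (t.reg 3)
      (t.val (2 + s) (t.reg 3) + t.val (17 + s) 0) ∧
    ((join s).run t).val (5 + s) = Function.update (t.val (5 + s)) (t.reg 3)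
      ((t.val (5 + s) (t.reg 3) + t.val (14 + s) 0) ⊓
        (t.val (8 + s) (t.reg 3) + t.val (11 + s) 0)) ∧
    ((join s).run t).val (8 + s) = Function.update (t.val (8 + s)) (t.reg 3)
      (t.val (8 + s) (t.reg 3) + t.val (14 + s) 0) := by
  simp only [run, IExp.eval, join, State.setVal, VRef.eval]
  refine ⟨trivial, trivial, trivial, trivial, fun a h20 h2 h5 h8 => ?_, ?_⟩
  · simp [h2, h5, h8, h20.ne]
  · interval_cases s <;> simp

theorem run_joinSon (t : State) :
    (joinSon.run t).reg = t.reg ∧ (joinSon.run t).idx = t.idx ∧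
    (joinSon.run t).adds = t.adds + 12 ∧ (joinSon.run t).mins ≤ t.mins + 9 ∧
    ∀ s < 3,
      (∀ x ≠ t.reg 3, (joinSon.run t).val (2 + s) x = t.val (2 + s) x ∧
        (joinSon.run t).val (5 + s) x = t.val (5 + s) x ∧
        (joinSon.run t).val (8 + s) x = t.val (8 + s) x) ∧
      (joinSon.run t).val (2 + s) (t.reg 3) =
        t.val (2 + s) (t.reg 3) + (contribution t s).2.2 ∧
      (joinSon.run t).val (5 + s) (t.reg 3) =
        (t.val (5 + s) (t.reg 3) + (contribution t s).2.1) ⊓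
          (t.val (8 + s) (t.reg 3) + (contribution t s).1) ∧
      (joinSon.run t).val (8 + s) (t.reg 3) =
        t.val (8 + s) (t.reg 3) + (contribution t s).2.1 := by
  obtain ⟨r, i, ad, mi, v, vc⟩ := run_contribute t
  rw [joinSon, run, run, run]
  set t₀ := contribute.run t
  obtain ⟨r₀, i₀, ad₀, mi₀, v₀, a₀, b₀, c₀⟩ := run_join (s := 0) (by omega) t₀
  set t₁ := (join 0).run t₀
  obtain ⟨r₁, i₁, ad₁, mi₁, v₁, a₁, b₁, c₁⟩ := run_join (s := 1) (by omega) t₁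
  set t₂ := (join 1).run t₁
  obtain ⟨r₂, i₂, ad₂, mi₂, v₂, a₂, b₂, c₂⟩ := run_join (s := 2) (by omega) t₂
  set t₃ := (join 2).run t₂
  refine ⟨by rw [r₂, r₁, r₀, r], by rw [i₂, i₁, i₀, i], by omega, by omega, fun s hs => ?_⟩
  obtain ⟨ca, cb, cc⟩ := vc s hs
  rw [← ca, ← cb, ← cc]
  have e₁ : t₁.reg 3 = t.reg 3 := by rw [r₀, r]
  have e₂ : t₂.reg 3 = t.reg 3 := by rw [r₁, e₁]
  have e₀ : t₀.reg 3 = t.reg 3 := by rw [r]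
  interval_cases s
  · simp only [Nat.add_zero] at *
    simp +contextual [v₂, v₁, a₀, b₀, c₀, e₀, v]
  · norm_num at a₁ b₁ c₁ ⊢
    simp +contextual [v₂, v₀, a₁, b₁, c₁, e₁, v]
  · norm_num at a₂ b₂ c₂ ⊢
    simp +contextual [v₁, v₀, a₂, b₂, c₂, e₂, v]

end Prog

end Cactus

namespace Cactus

variable {V : Type*} [Fintype V] {G : SimpleGraph V} {D : DFSData G} {w : V → ℝ} {t : State}

/-! ### Correctness of the program -/

theorem table_dfn {α : Type*} [Zero α] (f : V → α) (v : V) : table D f (D.dfn v) = f v := by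
  simp [table]

theorem DFSData.exists_dfn (D : DFSData G) {i : ℕ} (hi : i < Fintype.card V) :
    ∃ v, (D.dfn v : ℕ) = i :=
  ⟨D.dfn.symm ⟨i, hi⟩, by simp⟩

/-- The state contains the number of vertices and the arrays `FATHER` and `ROOT`. -/
structure State.IsLoaded (D : DFSData G) (t : State) : Prop where
  card : t.reg 0 = Fintype.card V
  father : ∀ v, t.idx 0 (D.dfn v) = D.dfn (D.father v)
  root : ∀ v, t.idx 1 (D.dfn v) = D.dfn (D.root v)

/-- The cycle that contains the tree edge above `c` continues above the father of `c`. -/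
def DFSData.Continues (D : DFSData G) (c : V) : Prop :=
  D.root c ≠ c ∧ D.root c ≠ D.father c

/-- The weights are loaded, and the index array 4 is zero exactly at those vertices that do not
continue the cycle of a son; no additions or `min`-operations have been carried out. -/
structure State.IsMarked (D : DFSData G) (w : V → ℝ) (t : State) : Prop extends
    t.IsLoaded D where
  weight : ∀ v, t.val 0 (D.dfn v) = w v
  marked : ∀ v, t.idx 4 (D.dfn v) = 0 ↔ ∀ c, D.father c = v → ¬ D.Continues c
  adds : t.adds = 0
  mins : t.mins = 0

theorem DFSData.exists_back_iff_marked (hG : IsCactus G) {x : V} :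
    (∃ z, D.Back x z) ↔ D.root x ≠ x ∧ ∀ c, D.father c = x → ¬ D.Continues c := by
  rw [D.exists_back_iff hG]
  refine and_congr_right fun _ => forall_congr' fun c => ?_
  constructor
  · rintro h rfl ⟨h1, h2⟩
    obtain ⟨y, hy⟩ := exists_covers_of_root_ne h1
    exact h2 (h (by have := hy.lt; omega) rfl h1)
  · rintro h - rfl h1
    by_contra h2
    exact h rfl ⟨h1, h2⟩

/-- The three cells of the vertex `v` for the mode `s` hold the values of the part `S` with
top `v`. -/
abbrev State.Holds (t : State) (D : DFSData G) (w : V → ℝ) (S : V → Prop) (s : ℕ)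
    (v : V) : Prop :=
  IsTable D w S s v (t.val (2 + s) (D.dfn v)) (t.val (5 + s) (D.dfn v)) (t.val (8 + s) (D.dfn v))

/-- The vertices of number at least `k` have been joined to their fathers, at the cost of at most
12 additions and 9 `min`-operations each. -/
structure State.IsJoined (D : DFSData G) (w : V → ℝ) (k : ℕ) (t : State) :
    Prop extends t.IsLoaded D where
  holds : ∀ v, (D.dfn v : ℕ) < k → ∀ s < 3, t.Holds D w (D.Part k v) s v
  adds : t.adds + 12 * k ≤ 12 * Fintype.card V
  mins : t.mins + 9 * k ≤ 9 * Fintype.card V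

namespace Prog

theorem isMarked_run_mark (D : DFSData G) (w : V → ℝ) :
    (mark.run (inputState D w)).IsMarked D w := by
  have key := loop_induct (x := 1) (e := .reg 0) (s := inputState D w)
    (P := .ifEq (.get 1 (.reg 1)) (.reg 1) .skip <|
      .ifEq (.get 1 (.reg 1)) (.get 0 (.reg 1)) .skip <|
        .setIdx 4 (.get 0 (.reg 1)) (.const 1))
    (fun i t => t.IsLoaded D ∧ (∀ v, t.val 0 (D.dfn v) = w v) ∧
      (∀ v, t.idx 4 (D.dfn v) = 0 ↔ ∀ c, (D.dfn c : ℕ) < i → D.father c = v → ¬ D.Continues c) ∧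
      t.adds = 0 ∧ t.mins = 0)
    ⟨⟨rfl, table_dfn fun v => (D.dfn (D.father v) : ℕ), table_dfn fun v => (D.dfn (D.root v) : ℕ)⟩,
      table_dfn fun v => (w v : EReal),
      fun v => by simp [inputState], rfl, rfl⟩ ?_
  · have hc : (IExp.reg 0).eval (inputState D w) = Fintype.card V := rfl
    rw [hc] at key
    obtain ⟨h1, h2, h3, h4, h5⟩ := key
    exact ⟨h1, h2, fun v => (h3 v).trans (forall_congr' fun c => by simp), h4, h5⟩
  · intro i hi t ⟨h1, h2, h3, h4, h5⟩
    obtain ⟨v, rfl⟩ := D.exists_dfn (show i < Fintype.card V from hi)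
    have hsucc : ∀ c, (D.dfn c : ℕ) < D.dfn v + 1 ↔ (D.dfn c : ℕ) < D.dfn v ∨ c = v := fun c => by
      rw [Nat.lt_succ_iff_lt_or_eq]
      exact or_congr_right ⟨fun h => DFSData.eq_of_dfn h, fun h => by rw [h]⟩
    have hinj : ∀ x y, (D.dfn x : ℕ) = D.dfn y ↔ x = y := fun x y =>
      ⟨fun h => DFSData.eq_of_dfn h, fun h => by rw [h]⟩
    have e1 : (IExp.get 1 (.reg 1)).eval (t.setReg 1 (D.dfn v)) =
        (IExp.reg 1).eval (t.setReg 1 (D.dfn v)) ↔ D.root v = v := by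
      simp [IExp.eval, State.setReg, h1.root, hinj]
    have e2 : (IExp.get 1 (.reg 1)).eval (t.setReg 1 (D.dfn v)) =
        (IExp.get 0 (.reg 1)).eval (t.setReg 1 (D.dfn v)) ↔ D.root v = D.father v := by
      simp [IExp.eval, State.setReg, h1.root, h1.father, hinj]
    have e3 : (IExp.get 0 (.reg 1)).eval (t.setReg 1 (D.dfn v)) = D.dfn (D.father v) := by
      simp [IExp.eval, State.setReg, h1.father]
    rw [run, run, run]
    by_cases hv : D.Continues v
    · rw [if_neg (mt e1.1 hv.1), if_neg (mt e2.1 hv.2), run, e3]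
      refine ⟨⟨?_, ?_, ?_⟩, h2, fun x => ?_, h4, h5⟩
      · simpa [State.setIdx, State.setReg] using h1.card
      · simpa [State.setIdx, State.setReg] using h1.father
      · simpa [State.setIdx, State.setReg] using h1.root
      · simp only [State.setIdx, State.setReg, IExp.eval, Function.update_self,
          Function.update_apply]
        split_ifs with hx
        · simp only [false_iff, not_forall, not_not]
          exact ⟨v, by omega, ((hinj _ _).1 hx).symm, hv⟩
        · rw [h3]
          refine forall_congr' fun c => ?_
          rw [hsucc]
          refine ⟨?_, fun h hc => h (.inl hc)⟩
          rintro h (hc | rfl)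
          · exact h hc
          · exact fun h => absurd (by rw [h]) hx
    · suffices H : (t.setReg 1 (D.dfn v)).IsLoaded D ∧
          ∀ x, t.idx 4 (D.dfn x) = 0 ↔
            ∀ c, (D.dfn c : ℕ) < D.dfn v + 1 → D.father c = x → ¬ D.Continues c by
        split_ifs with a b
        · exact ⟨H.1, h2, H.2, h4, h5⟩
        · exact ⟨H.1, h2, H.2, h4, h5⟩
        · exact absurd ⟨mt e1.2 a, mt e2.2 b⟩ hv
      refine ⟨⟨by simpa [State.setReg] using h1.card, h1.father, h1.root⟩, fun x => ?_⟩
      rw [h3]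
      refine forall_congr' fun c => ?_
      rw [hsucc]
      refine ⟨?_, fun h hc => h (.inl hc)⟩
      rintro h (hc | rfl)
      · exact h hc
      · exact fun _ => hv

theorem isJoined_run_start (hG : IsCactus G) (ht : t.IsMarked D w) :
    (start.run t).IsJoined D w (Fintype.card V) := by
  classical
  have key := loop_induct (x := 1) (e := .reg 0) (s := t)
    (P := .seq (single 0) <| .seq (single 1) <| .seq (single 2) <|
      .ifEq (.get 1 (.reg 1)) (.reg 1) .skip <|
        .ifEq (.get 4 (.reg 1)) (.const 0)
          (.seq (.zero ⟨5, .reg 1⟩) (.infty ⟨10, .reg 1⟩)) .skip)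
    (fun i t => t.IsMarked D w ∧
      ∀ v, (D.dfn v : ℕ) < i → ∀ s < 3, t.Holds D w (D.Part (Fintype.card V) v) s v)
    ⟨ht, by simp⟩ ?_
  · have hc : (IExp.reg 0).eval t = Fintype.card V := ht.card
    rw [hc] at key
    exact ⟨key.1.toIsLoaded, key.2, by rw [start, key.1.adds, zero_add],
      by rw [start, key.1.mins, zero_add]⟩
  · intro i hi t ⟨h1, h2⟩
    rw [IExp.eval, ht.card] at hi
    obtain ⟨v, rfl⟩ := D.exists_dfn hi
    have hinj : ∀ x y, (D.dfn x : ℕ) = D.dfn y ↔ x = y := fun x y =>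
      ⟨fun h => DFSData.eq_of_dfn h, fun h => by rw [h]⟩
    have hback := D.exists_back_iff_marked hG (x := v)
    rw [← h1.marked] at hback
    rw [run, run, run, run, run]
    set t' := (single 2).run ((single 1).run ((single 0).run (t.setReg 1 (D.dfn v)))) with ht'
    have hreg : t'.reg = Function.update t.reg 1 (D.dfn v : ℕ) := rfl
    have hidx : t'.idx = t.idx := rfl
    have e1 : (IExp.get 1 (.reg 1)).eval t' = (IExp.reg 1).eval t' ↔ D.root v = v := by
      simp [IExp.eval, hreg, hidx, h1.root, hinj]
    have e2 : (IExp.get 4 (.reg 1)).eval t' = (IExp.const 0).eval t' ↔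
        t.idx 4 (D.dfn v) = 0 := by
      simp [IExp.eval, hreg, hidx]
    have hval : t'.val 0 = t.val 0 ∧ ∀ s < 3,
        t'.val (2 + s) = Function.update (t.val (2 + s)) (D.dfn v) (t.val 0 (D.dfn v)) ∧
        t'.val (5 + s) = Function.update (t.val (5 + s)) (D.dfn v) ⊤ ∧
        t'.val (8 + s) = Function.update (t.val (8 + s)) (D.dfn v) 0 := by
      simp only [ht', run, single, IExp.eval, State.setReg, State.setVal, VRef.eval,
        Function.update_self]
      refine ⟨by simp, fun s hs => ?_⟩
      interval_cases s <;> simp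
    obtain ⟨hval0, hval⟩ := hval
    have hother : ∀ x, (D.dfn x : ℕ) < D.dfn v + 1 → x ≠ v → (D.dfn x : ℕ) < D.dfn v :=
      fun x hx hxv => by
        have := mt (hinj x v).1 hxv
        omega
    by_cases hb : ∃ z, D.Back v z
    · rw [if_neg (mt e1.1 (hback.1 hb).1), run, if_pos (e2.2 (hback.1 hb).2)]
      simp only [run, IExp.eval, State.setVal, hreg, Function.update_self]
      refine ⟨⟨⟨by simpa [hreg] using h1.card, h1.father, h1.root⟩, fun x => ?_, h1.marked,
        h1.adds, h1.mins⟩, fun x hx s hs => ?_⟩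
      · simpa [hval0] using h1.weight x
      · obtain ⟨q1, q2, q3⟩ := hval s hs
        by_cases hxv : x = v
        · subst hxv
          have := IsTable.single D w s x
          simp only [hb, and_true] at this
          interval_cases s <;> simp at q1 q2 q3 <;>
            simpa [State.Holds, h1.weight, q1, q2, q3] using this
        · have := h2 x (hother x hx hxv) s hs
          interval_cases s <;> simp at q1 q2 q3 <;>
            simpa [State.Holds, Function.update_apply, hinj, hxv, q1, q2, q3] using this
    · suffices H : t'.IsMarked D w ∧ ∀ x, (D.dfn x : ℕ) < D.dfn v + 1 → ∀ s < 3,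
          t'.Holds D w (D.Part (Fintype.card V) x) s x by
        split_ifs with a
        · exact H
        · rw [run, if_neg fun b => hb (hback.2 ⟨mt e1.2 a, e2.1 b⟩)]
          exact H
      refine ⟨⟨⟨by simpa [hreg] using h1.card, h1.father, h1.root⟩, fun x => ?_, h1.marked,
        h1.adds, h1.mins⟩, fun x hx s hs => ?_⟩
      · rw [hval0, h1.weight]
      · obtain ⟨q1, q2, q3⟩ := hval s hs
        rw [State.Holds, q1, q2, q3]
        by_cases hxv : x = v
        · subst hxv
          simpa [hb, h1.weight] using IsTable.single D w s x
        · simpa [Function.update_apply, hinj, hxv] using h2 x (hother x hx hxv) s hs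

theorem isJoined_run_joinSon (hG : IsCactus G) {u : V} (hu : (D.dfn u : ℕ) ≠ 0)
    (ht : t.IsJoined D w (D.dfn u + 1)) (h2 : t.reg 2 = D.dfn u)
    (h3 : t.reg 3 = D.dfn (D.father u)) : (joinSon.run t).IsJoined D w (D.dfn u) := by
  obtain ⟨hr, hi, ha, hm, hv⟩ := run_joinSon t
  have hadds := ht.adds
  have hmins := ht.mins
  refine ⟨⟨by rw [hr, ht.card], by rw [hi]; exact ht.father, by rw [hi]; exact ht.root⟩, ?_,
    by omega, by omega⟩
  intro v hvu s hs
  obtain ⟨hne, e1, e2, e3⟩ := hv s hs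
  have hold := ht.holds v (by omega) s hs
  by_cases hvf : v = D.father u
  · subst hvf
    rw [h3] at e1 e2 e3
    rw [State.Holds, e1, e2, e3]
    have hson := fun s hs => ht.holds u (by omega) s hs
    have hcond : t.idx 1 (D.dfn u) = D.dfn (D.father u) ↔ D.root u = D.father u := by
      rw [ht.root]
      exact ⟨fun h => DFSData.eq_of_dfn h, fun h => by rw [h]⟩
    by_cases hroot : D.root u = D.father u
    · simp only [contribution, h2, h3, if_pos (hcond.2 hroot)]
      exact hold.join_of_root_eq hG rfl hu hroot (hson 0 (by omega)) (hson 1 (by omega))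
        (hson 2 (by omega))
    · simp only [contribution, h2, h3, if_neg (mt hcond.1 hroot)]
      exact hold.join_of_root_ne rfl hu hroot (hson s hs)
  · obtain ⟨e1, e2, e3⟩ := hne (D.dfn v) fun h => hvf (DFSData.eq_of_dfn (h.trans h3))
    rw [State.Holds, e1, e2, e3]
    exact hold.of_ne rfl hu hvf

theorem isJoined_run_joinAll (hG : IsCactus G) (ht : t.IsJoined D w (Fintype.card V)) :
    (joinAll.run t).IsJoined D w 1 := by
  have hpos : 0 < Fintype.card V := Fintype.card_pos_iff.2 hG.connected.nonempty
  have key := loop_induct (x := 1) (e := .sub (.reg 0) (.const 1)) (s := t)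
    (P := .seq (.setReg 2 (.sub (.sub (.reg 0) (.const 1)) (.reg 1))) <|
      .seq (.setReg 3 (.get 0 (.reg 2))) joinSon)
    (fun i t => t.IsJoined D w (Fintype.card V - i)) ht ?_
  · have hc : (IExp.sub (.reg 0) (.const 1)).eval t = Fintype.card V - 1 := by
      rw [← ht.card]
      rfl
    rw [hc, Nat.sub_sub_self hpos] at key
    exact key
  · intro i hi t' h
    have hi' : i < Fintype.card V - 1 := by
      rw [← ht.card]
      exact hi
    obtain ⟨u, hu⟩ := D.exists_dfn (i := Fintype.card V - 1 - i) (by omega)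
    have e1 : Fintype.card V - i = D.dfn u + 1 := by omega
    have e2 : Fintype.card V - (i + 1) = D.dfn u := by omega
    rw [e1] at h
    rw [e2, run, run, run, run]
    apply isJoined_run_joinSon hG (by omega)
    · exact ⟨⟨by simpa [State.setReg] using h.card, h.father, h.root⟩, h.holds, h.adds, h.mins⟩
    · simp [State.setReg, IExp.eval, h.card, hu]
    · simp [State.setReg, IExp.eval, h.card, ← hu, h.father]

theorem run_domination (hG : IsCactus G) (D : DFSData G) (w : V → ℝ) :
    (domination.run (inputState D w)).output = weightedDominationNumber G w ∧
    (domination.run (inputState D w)).adds < 12 * Fintype.card V ∧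
    (domination.run (inputState D w)).mins < 9 * Fintype.card V := by
  have h := isJoined_run_joinAll hG (isJoined_run_start hG (isMarked_run_mark D w))
  obtain ⟨v, hv⟩ := D.exists_dfn (i := 0) (Fintype.card_pos_iff.2 hG.connected.nonempty)
  have hadds := h.adds
  have hmins := h.mins
  refine ⟨?_, ?_, ?_⟩
  · have := (h.holds v (by omega) 1 (by omega)).inf_eq hv
    rw [hv] at this
    rw [← this]
    simp [domination, run, State.output, State.setVal, VRef.eval, IExp.eval]
  · simp only [domination, run, State.setVal]
    omega
  · simp only [domination, run, State.setVal]
    omega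

end Prog

end Cactus

theorem theorem1 :
    ∃ P : Cactus.Prog, ∀ (V : Type*) [Fintype V] (G : SimpleGraph V) (_ : Cactus.IsCactus G)
      (w : V → ℝ) (_ : ∀ v, 0 < w v) (D : Cactus.DFSData G),
      Cactus.numBlocks G < Fintype.card V ∧
      (P.run (Cactus.inputState D w)).output = (Cactus.weightedDominationNumber G w : EReal) ∧
      (P.run (Cactus.inputState D w)).adds < 12 * Fintype.card V + 5 * Cactus.numBlocks G ∧
      (P.run (Cactus.inputState D w)).mins < 9 * Fintype.card V + 2 * Cactus.numBlocks G := by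
  refine ⟨Cactus.Prog.domination, fun V _ G hG w _ D => ?_⟩
  obtain ⟨h1, h2, h3⟩ := Cactus.Prog.run_domination hG D w
  exact ⟨Cactus.numBlocks_lt hG D, h1, by omega, by omega⟩
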